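/- **Setting.** Let $d\ge 1$ and let $V$ be $2d$-dimensional Lebesgue measure on $\mathbb C^d$, normalised so that the Euclidean unit ball has mass $1$. For a non-empty open $\Omega\subset\mathbb C^d$ let $A^2(\Omega)$ be the Bergman space of holomorphic $f:\Omega\to\mathbb C$ with $\int_\Omega|f|^2\,dV<\infty$, a Hilbert space with the inner product of $L^2(\Omega,dV)$. Write $A\Subset B$ if $\overline A$ is a compact subset of $B$. A *holomorphic map-weight system* $(\Omega,\phi_i,w_i)_{i\in\mathcal I}$, with $\mathcal I$ finite or countably infinite, consists of holomorphic maps $\phi_i:\Omega\to\Omega$ with $\bigcup_{i}\phi_i(\Omega)\Subset\Omega$ and functions $w_i\in A^2(\Omega)$ with $\sum_{i}|w_i|\in L^2(\Omega,dV)$. Its transfer operator is $(\mathcal Lf)(z)=\sum_{i\in\mathcal I}w_i(z)f(\phi_i(z))$. A set $D\subset\mathbb C^d$ is *strictly circled with centre $\zeta$* if $\mu(D-\zeta)\Subset D-\zeta$ for all $\mu\in\mathbb C$ with $|\mu|<1$; for $r>0$ put $D(r)=r(D-\zeta)+\zeta$. For non-empty open $\Omega_2\Subset\Omega_1$, a *relative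 cover* of $(\Omega_1,\Omega_2)$ of size $N\ge1$ is a collection of strictly circled open sets $D_1,\dots,D_N$ with $\Omega_2\subset\bigcup_nD_n$ for which there are $\gamma_1,\dots,\gamma_N>1$ with $\bigcup_nD_n(\gamma_n)\subset\Omega_1$; for such a choice, $\Gamma=(\log\gamma_1,\dots,\log\gamma_N)$ is its *efficiency*. Put $\|(x_1,\dots,x_N)\|_d=\big(\sum_{j}|x_j|^{-d}\big)^{-1/d}$. For a compact operator $A$ on a Hilbert space, $\lambda(A)=(\lambda_n(A))_{n\ge1}$ is its eigenvalue sequence, with decreasing moduli and each non-zero eigenvalue repeated according to algebraic multiplicity (continued by zeros if there are only finitely many non-zero eigenvalues), and $s_n(A)=\sqrt{\lambda_n(A^*A)}$. For $a,\alpha>0$ put $|x|_{a,\alpha}=\sup_{n\ge1}|x_n|\exp(an^\alpha)$ for complex sequences $x$ and $|A|_{a,\alpha}=\sup_{n\ge1}s_n(A)\exp(an^\alpha)$ for compact operators $A$; let $\mathcal E(a,\alpha)$ be the set of sequences, and $E(a,\alpha)$ the set of compact operators, for which these are finite. **Theorem.** Let $(\Omega,\phi_i,w_i)_{i\in\mathcal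 I}$ be a holomorphic map-weight system on a non-empty open $\Omega\subset\mathbb C^d$. Let $\widetilde\Omega$ be a non-empty open set with $$\bigcup_{i\in\mathcal I}\phi_i(\Omega)\Subset\widetilde\Omega\Subset\Omega,$$ and suppose that $(\Omega,\widetilde\Omega)$ has a relative cover of size $N$ with efficiency $\Gamma$. Put $c=\|\Gamma\|_d$ and $r_i=\operatorname{dist}(\phi_i(\Omega),\partial\widetilde\Omega)$. Then the series defining $\mathcal L$ converges pointwise on $\Omega$ and in $A^2(\Omega)$ for every $f\in A^2(\Omega)$ and defines a bounded operator $\mathcal L:A^2(\Omega)\to A^2(\Omega)$; this operator is compact and belongs to $E(c,1/d)$, with $$|\mathcal L|_{c,1/d}\le N\,e^{-\frac{d-1}{2}\min(\Gamma)}\,\Big\|\sum_{i\in\mathcal I}|w_i|\,r_i^{-d}\Big\|_{L^2(\Omega)};$$ and its eigenvalue sequence exists and satisfies $\lambda(\mathcal L)\in\mathcal E\big(\tfrac{dc}{1+d},\tfrac1d\big)$ with $|\lambda(\mathcal L)|_{dc/(1+d),1/d}\le|\mathcal L|_{c,1/d}$. In particular, $$|\lambda_n(\mathcal L)|\le|\mathcal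 L|_{c,1/d}\exp\Big(-\frac{dc}{1+d}\,n^{1/d}\Big)\quad\text{for all }n\in\mathbb N=\{1,2,\dots\}.$$ -/

import Mathlib

open MeasureTheory Metric Filter Topology TopologicalSpace
open scoped ENNReal

noncomputable section

namespace Bergman

/-- Complex Euclidean space of dimension `d`, with the Euclidean norm. -/
abbrev CSpace (d : ℕ) : Type := EuclideanSpace ℂ (Fin d)

/-- `2d`-dimensional Lebesgue measure on `ℂ^d`, normalised so that the Euclidean unit ball has unit
mass. -/
def V (d : ℕ) : Measure (CSpace d) :=
  (volume (ball (0 : CSpace d) 1))⁻¹ • (volume : Measure (CSpace d))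

/-- Compact containment: the closure of `A` is a compact subset of `B`. -/
def CompactlyContained {X : Type*} [TopologicalSpace X] (A B : Set X) : Prop :=
  IsCompact (closure A) ∧ closure A ⊆ B

section BergmanSpace

variable {d : ℕ}

/-- The holomorphic functions on `Ω` that are square integrable over `Ω`, as a vector space. A
function on `Ω` is encoded by its extension by zero to `ℂ^d`. -/
def A2Submodule (Ω : Opens (CSpace d)) : Submodule ℂ (CSpace d → ℂ) where
  carrier := {f | DifferentiableOn ℂ f Ω ∧ MemLp f 2 ((V d).restrict Ω) ∧ ∀ z ∉ Ω, f z = 0}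
  add_mem' := fun {f g} hf hg =>
    ⟨hf.1.add hg.1, hf.2.1.add hg.2.1, fun z hz => by simp [hf.2.2 z hz, hg.2.2 z hz]⟩
  zero_mem' := ⟨differentiableOn_const 0, MemLp.zero', fun _ _ => rfl⟩
  smul_mem' := fun c f hf =>
    ⟨hf.1.const_smul c, hf.2.1.const_smul c, fun z hz => by simp [hf.2.2 z hz]⟩

/-- The Bergman space `A²(Ω)`. -/
def A2 (Ω : Opens (CSpace d)) : Type := A2Submodule Ω

namespace A2

variable {Ω : Opens (CSpace d)}

instance : AddCommGroup (A2 Ω) := inferInstanceAs (AddCommGroup (A2Submodule Ω))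
instance : Module ℂ (A2 Ω) := inferInstanceAs (Module ℂ (A2Submodule Ω))
instance : CoeFun (A2 Ω) (fun _ => CSpace d → ℂ) := ⟨fun f => f.1⟩

theorem differentiableOn (f : A2 Ω) : DifferentiableOn ℂ f Ω := f.2.1
theorem memLp (f : A2 Ω) : MemLp f 2 ((V d).restrict Ω) := f.2.2.1
theorem eq_zero (f : A2 Ω) {z : CSpace d} (hz : z ∉ Ω) : f z = 0 := f.2.2.2 z hz
@[simp] theorem add_apply (f g : A2 Ω) (z : CSpace d) : (f + g) z = f z + g z := rfl
@[simp] theorem sub_apply (f g : A2 Ω) (z : CSpace d) : (f - g) z = f z - g z := rfl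
@[simp] theorem smul_apply (c : ℂ) (f : A2 Ω) (z : CSpace d) : (c • f) z = c * f z := rfl

theorem ext {f g : A2 Ω} (h : ∀ z ∈ Ω, f z = g z) : f = g := by
  apply Subtype.ext
  funext z
  by_cases hz : z ∈ Ω
  · exact h z hz
  · rw [f.eq_zero hz, g.eq_zero hz]

theorem measurable (f : A2 Ω) : Measurable (f : CSpace d → ℂ) := by
  have h : (f : CSpace d → ℂ) = (Ω : Set (CSpace d)).indicator f := by
    funext z
    by_cases hz : z ∈ Ω
    · rw [Set.indicator_of_mem (by exact hz)]
    · rw [Set.indicator_of_notMem (by exact hz), f.eq_zero hz]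
  classical
  rw [h, ← Set.piecewise_eq_indicator]
  exact f.differentiableOn.continuousOn.measurable_piecewise continuousOn_const
    Ω.isOpen.measurableSet

end A2

theorem volume_unitBall_ne_zero : volume (ball (0 : CSpace d) 1) ≠ 0 :=
  (measure_ball_pos volume 0 one_pos).ne'

theorem volume_unitBall_ne_top : volume (ball (0 : CSpace d) 1) ≠ ∞ := measure_ball_lt_top.ne

instance : (V d).IsAddHaarMeasure :=
  Measure.IsAddHaarMeasure.smul _ (ENNReal.inv_ne_zero.2 volume_unitBall_ne_top)
    (ENNReal.inv_ne_top.2 volume_unitBall_ne_zero)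

theorem V_unitBall : V d (ball 0 1) = 1 := by
  simp only [V, Measure.smul_apply, smul_eq_mul]
  exact ENNReal.inv_mul_cancel volume_unitBall_ne_zero volume_unitBall_ne_top

namespace A2

variable {Ω : Opens (CSpace d)}

/-- The class in `L²(Ω, dV)` of an element of the Bergman space. -/
def toL2 (Ω : Opens (CSpace d)) : A2 Ω →ₗ[ℂ] Lp ℂ 2 ((V d).restrict Ω) where
  toFun f := f.memLp.toLp f
  map_add' f g := MemLp.toLp_add f.memLp g.memLp
  map_smul' c f := MemLp.toLp_const_smul c f.memLp

theorem toL2_injective : Function.Injective (toL2 Ω) := by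
  intro f g h
  have h1 : (f : CSpace d → ℂ) =ᵐ[(V d).restrict Ω] g :=
    (MemLp.toLp_eq_toLp_iff f.memLp g.memLp).1 h
  exact ext (fun z hz => Measure.eqOn_open_of_ae_eq h1 Ω.isOpen
    f.differentiableOn.continuousOn g.differentiableOn.continuousOn hz)

/-- The norm of `A²(Ω)` is the `L²` norm. -/
instance : NormedAddCommGroup (A2 Ω) := NormedAddCommGroup.induced _ _ (toL2 Ω) toL2_injective

/-- The inner product of `A²(Ω)` is that of `L²(Ω, dV)`. -/
instance : InnerProductSpace ℂ (A2 Ω) where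
  norm_smul_le c f := by
    change ‖toL2 Ω (c • f)‖ ≤ ‖c‖ * ‖toL2 Ω f‖
    rw [map_smul, norm_smul]
  inner f g := inner ℂ (toL2 Ω f) (toL2 Ω g)
  norm_sq_eq_re_inner f := norm_sq_eq_re_inner (𝕜 := ℂ) (toL2 Ω f)
  conj_inner_symm f g := inner_conj_symm _ _
  add_left f g h := by rw [map_add, inner_add_left]
  smul_left f g c := by rw [map_smul, inner_smul_left]

theorem inner_def (f g : A2 Ω) :
    inner ℂ f g = ∫ z in Ω, (starRingEnd ℂ) (f z) * g z ∂(V d) := by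
  change inner ℂ (toL2 Ω f) (toL2 Ω g) = _
  rw [L2.inner_def]
  refine integral_congr_ae ?_
  filter_upwards [f.memLp.coeFn_toLp, g.memLp.coeFn_toLp] with z h1 h2
  change inner ℂ (f.memLp.toLp f z) (g.memLp.toLp g z) = _
  rw [h1, h2, RCLike.inner_apply, mul_comm]

theorem enorm_def (f : A2 Ω) : ‖f‖ₑ = eLpNorm f 2 ((V d).restrict Ω) := by
  have h : ‖f‖ = ‖toL2 Ω f‖ := rfl
  rw [← ofReal_norm, h, ofReal_norm]
  exact Lp.enorm_toLp f.memLp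

end A2

/-- Sub-mean value property over balls. -/
theorem enorm_mul_le_lintegral {h : CSpace d → ℂ} (hm : Measurable h) {z : CSpace d} {r : ℝ}
    (hd : DifferentiableOn ℂ h (ball z r)) :
    ‖h z‖ₑ * V d (ball 0 r) ≤ ∫⁻ v in ball 0 r, ‖h (z + v)‖ₑ ∂(V d) := by
  set ν : Measure ℝ := volume.restrict (Set.Ioc 0 (2 * Real.pi)) with hν
  have hν0 : ν Set.univ = ENNReal.ofReal (2 * Real.pi) := by simp [hν]
  have hpi : (0 : ℝ) < 2 * Real.pi := by positivity
  have hν1 : ν Set.univ ≠ 0 := by rw [hν0]; simpa using hpi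
  have hν2 : ν Set.univ ≠ ∞ := by rw [hν0]; exact ENNReal.ofReal_ne_top
  -- the mean value property along the circles `θ ↦ z + e^{iθ} v`
  have key : ∀ v ∈ ball (0 : CSpace d) r,
      ‖h z‖ₑ * ν Set.univ ≤ ∫⁻ θ, ‖h (z + circleMap 0 1 θ • v)‖ₑ ∂ν := by
    intro v hv
    have hmaps : Set.MapsTo (fun ζ : ℂ => z + ζ • v) (closedBall 0 1) (ball z r) := by
      intro ζ hζ
      simp only [mem_closedBall, dist_zero_right] at hζ
      simp only [mem_ball, dist_self_add_left, norm_smul] at hv ⊢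
      rw [dist_zero_right] at hv
      nlinarith [norm_nonneg v]
    have hdiff : DifferentiableOn ℂ (fun ζ : ℂ => h (z + ζ • v)) (closedBall 0 1) :=
      hd.comp (by fun_prop) hmaps
    have hcl : DiffContOnCl ℂ (fun ζ : ℂ => h (z + ζ • v)) (ball 0 |1|) := by
      rw [abs_one]
      exact DifferentiableOn.diffContOnCl (by rwa [closure_ball _ one_ne_zero])
    have h1 := hcl.circleAverage
    rw [Real.circleAverage_def, zero_smul, add_zero,
      intervalIntegral.integral_of_le hpi.le] at h1
    rw [← h1, enorm_smul, hν0]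
    have h2 : ‖(2 * Real.pi)⁻¹‖ₑ * ENNReal.ofReal (2 * Real.pi) = 1 := by
      rw [Real.enorm_of_nonneg (by positivity), ← ENNReal.ofReal_mul (by positivity),
        inv_mul_cancel₀ hpi.ne', ENNReal.ofReal_one]
    rw [mul_right_comm, h2, one_mul]
    exact enorm_integral_le_lintegral_enorm _
  -- rotation invariance of the measure
  have hrot : ∀ θ : ℝ, ∫⁻ v in ball 0 r, ‖h (z + circleMap 0 1 θ • v)‖ₑ ∂(V d) =
      ∫⁻ v in ball 0 r, ‖h (z + v)‖ₑ ∂(V d) := by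
    intro θ
    have hc : ‖circleMap 0 1 θ‖ = 1 := by simp
    let e : CSpace d ≃ₗᵢ[ℝ] CSpace d :=
      { toLinearEquiv := (LinearEquiv.smulOfNeZero ℂ (CSpace d) (circleMap 0 1 θ)
          (by rw [← norm_ne_zero_iff, hc]; exact one_ne_zero)).restrictScalars ℝ
        norm_map' := fun v => by
          change ‖circleMap 0 1 θ • v‖ = ‖v‖
          rw [norm_smul, hc, one_mul] }
    have he : MeasurePreserving e (V d) (V d) := by
      refine ⟨e.continuous.measurable, ?_⟩
      rw [V, Measure.map_smul, e.measurePreserving.map_eq]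
    have hpre : e ⁻¹' ball 0 r = ball 0 r := by
      ext v; simp
    have h3 := he.setLIntegral_comp_preimage (s := ball 0 r) measurableSet_ball
      (f := fun v => ‖h (z + v)‖ₑ) (by fun_prop)
    rw [hpre] at h3
    exact h3
  have hfin : ‖h z‖ₑ * V d (ball 0 r) * ν Set.univ ≤
      (∫⁻ v in ball 0 r, ‖h (z + v)‖ₑ ∂(V d)) * ν Set.univ := by
    calc ‖h z‖ₑ * V d (ball 0 r) * ν Set.univ
        = ∫⁻ _ in ball 0 r, ‖h z‖ₑ * ν Set.univ ∂(V d) := by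
          rw [setLIntegral_const]; ring
      _ ≤ ∫⁻ v in ball 0 r, ∫⁻ θ, ‖h (z + circleMap 0 1 θ • v)‖ₑ ∂ν ∂(V d) :=
          setLIntegral_mono' measurableSet_ball key
      _ = ∫⁻ θ, ∫⁻ v in ball 0 r, ‖h (z + circleMap 0 1 θ • v)‖ₑ ∂(V d) ∂ν := by
          refine lintegral_lintegral_swap (Measurable.aemeasurable ?_)
          have : Continuous (fun p : CSpace d × ℝ => z + circleMap 0 1 p.2 • p.1) := by fun_prop
          exact (hm.comp this.measurable).enorm
      _ = ∫⁻ _, ∫⁻ v in ball 0 r, ‖h (z + v)‖ₑ ∂(V d) ∂ν := by simp_rw [hrot]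
      _ = _ := by rw [lintegral_const]
  exact (ENNReal.mul_le_mul_iff_left hν1 hν2).1 hfin

namespace A2

variable {Ω : Opens (CSpace d)}

/-- Point evaluations are bounded on the Bergman space. -/
theorem exists_norm_apply_le (d : ℕ) {r : ℝ} (hr : 0 < r) :
    ∃ C : ℝ, 0 ≤ C ∧ ∀ (Ω : Opens (CSpace d)) (f : A2 Ω) (z : CSpace d),
      ball z r ⊆ Ω → ‖f z‖ ≤ C * ‖f‖ := by
  have hV0 : V d (ball 0 r) ≠ 0 := (measure_ball_pos _ _ hr).ne'
  have hVt : V d (ball 0 r) ≠ ∞ := measure_ball_lt_top.ne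
  refine ⟨Real.sqrt ((V d (ball 0 r)).toReal⁻¹), Real.sqrt_nonneg _, fun Ω f z hz => ?_⟩
  have h1 : ‖f z‖ₑ ^ 2 * V d (ball 0 r) ≤ ‖f‖ₑ ^ 2 := by
    calc ‖f z‖ₑ ^ 2 * V d (ball 0 r) = ‖f z ^ 2‖ₑ * V d (ball 0 r) := by rw [enorm_pow]
      _ ≤ ∫⁻ v in ball 0 r, ‖f (z + v) ^ 2‖ₑ ∂(V d) :=
          enorm_mul_le_lintegral (h := fun z => f z ^ 2) (f.measurable.pow_const 2)
            ((f.differentiableOn.mono hz).pow 2)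
      _ = ∫⁻ v in ball z r, ‖f v ^ 2‖ₑ ∂(V d) := by
          have h3 := (measurePreserving_add_left (V d) z).setLIntegral_comp_preimage
            (s := ball z r) measurableSet_ball (f := fun v => ‖f v ^ 2‖ₑ)
            (f.measurable.pow_const 2).enorm
          rw [← h3]
          congr 2
          ext v; simp
      _ ≤ ∫⁻ v in Ω, ‖f v ^ 2‖ₑ ∂(V d) := lintegral_mono_set hz
      _ = ‖f‖ₑ ^ 2 := by
          rw [enorm_def, eLpNorm_eq_lintegral_rpow_enorm_toReal (by simp) (by simp)]
          simp only [ENNReal.toReal_ofNat, ENNReal.rpow_ofNat, enorm_pow, one_div]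
          rw [← ENNReal.rpow_natCast, ← ENNReal.rpow_mul]
          simp
  have h2 := ENNReal.toReal_mono (by simp) h1
  simp only [ENNReal.toReal_mul, ENNReal.toReal_pow, toReal_enorm] at h2
  have hpos : 0 < (V d (ball 0 r)).toReal := ENNReal.toReal_pos hV0 hVt
  refine abs_le_of_sq_le_sq' ?_ (by positivity) |>.2
  rw [mul_pow, Real.sq_sqrt (by positivity), inv_mul_eq_div, le_div_iff₀ hpos]
  exact h2

/-- Cauchy estimate for the derivative. -/
theorem norm_fderiv_le {f : CSpace d → ℂ} {z : CSpace d} {r M : ℝ} (hr : 0 < r)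
    (hd : DifferentiableOn ℂ f (ball z (2 * r))) (hM : ∀ y ∈ ball z (2 * r), ‖f y‖ ≤ M) :
    ‖fderiv ℂ f z‖ ≤ M / r := by
  have hM0 : 0 ≤ M := (norm_nonneg _).trans (hM z (mem_ball_self (by positivity)))
  refine ContinuousLinearMap.opNorm_le_bound _ (by positivity) fun v => ?_
  by_cases hv : v = 0
  · simp [hv]
  have hv0 : 0 < ‖v‖ := norm_pos_iff.2 hv
  have hR : 0 < r / ‖v‖ := by positivity
  have hmaps : Set.MapsTo (fun ζ : ℂ => z + ζ • v) (closedBall 0 (r / ‖v‖)) (ball z (2 * r)) := by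
    intro ζ hζ
    simp only [mem_closedBall, dist_zero_right] at hζ
    simp only [mem_ball, dist_self_add_left, norm_smul]
    have := (le_div_iff₀ hv0).1 hζ
    linarith
  have hcl : DiffContOnCl ℂ (fun ζ : ℂ => f (z + ζ • v)) (ball 0 (r / ‖v‖)) := by
    refine DifferentiableOn.diffContOnCl ?_
    rw [closure_ball _ hR.ne']
    exact hd.comp (by fun_prop) hmaps
  have h1 := Complex.norm_deriv_le_of_forall_mem_sphere_norm_le (C := M) hR hcl
    (fun ζ hζ => hM _ (hmaps (sphere_subset_closedBall hζ)))
  have h2 : HasFDerivAt f (fderiv ℂ f z) z :=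
    (hd.differentiableAt (isOpen_ball.mem_nhds (mem_ball_self (by positivity)))).hasFDerivAt
  have h3 : HasDerivAt (fun ζ : ℂ => f (z + ζ • v)) (fderiv ℂ f z v) 0 := by
    have h4 : HasDerivAt (fun ζ : ℂ => z + ζ • v) v 0 := by
      simpa using ((hasDerivAt_id (0 : ℂ)).smul_const v).const_add z
    exact HasFDerivAt.comp_hasDerivAt (0 : ℂ) (by simpa using h2) h4
  rw [h3.deriv] at h1
  calc ‖fderiv ℂ f z v‖ ≤ M / (r / ‖v‖) := h1
    _ = M / r * ‖v‖ := by field_simp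

theorem tendsto_of_cauchySeq (u : ℕ → A2 Ω) (hu : CauchySeq u) :
    ∃ f : A2 Ω, Tendsto u atTop (𝓝 f) := by
  have hball : ∀ z ∈ Ω, ∃ r : ℝ, 0 < r ∧ ball z (4 * r) ⊆ Ω := fun z hz => by
    obtain ⟨ε, hε, h⟩ := Metric.isOpen_iff.1 Ω.isOpen z hz
    exact ⟨ε / 4, by positivity, by rwa [mul_div_cancel₀ _ (by norm_num)]⟩
  have hdist : ∀ ε > 0, ∃ N, ∀ m ≥ N, ∀ n ≥ N, ‖u m - u n‖ < ε := fun ε hε => by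
    obtain ⟨N, hN⟩ := Metric.cauchySeq_iff.1 hu ε hε
    exact ⟨N, fun m hm n hn => by rw [← dist_eq_norm]; exact hN m hm n hn⟩
  -- pointwise limit
  have hpt : ∀ z, ∃ l, Tendsto (fun n => u n z) atTop (𝓝 l) := by
    intro z
    by_cases hz : z ∈ Ω
    · obtain ⟨r, hr, hzr⟩ := hball z hz
      obtain ⟨C, hC, hCf⟩ := exists_norm_apply_le d (r := 4 * r) (by positivity)
      refine cauchySeq_tendsto_of_complete (Metric.cauchySeq_iff.2 fun ε hε => ?_)
      obtain ⟨N, hN⟩ := hdist (ε / (C + 1)) (by positivity)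
      refine ⟨N, fun m hm n hn => ?_⟩
      have h1 := hCf Ω (u m - u n) z hzr
      have h2 := (lt_div_iff₀ (by positivity)).1 (hN m hm n hn)
      rw [dist_eq_norm, ← sub_apply]
      nlinarith [norm_nonneg (u m - u n)]
    · exact ⟨0, by simp [eq_zero _ hz]⟩
  choose g hg using hpt
  have hgdiff : DifferentiableOn ℂ g Ω := by
    intro z0 hz0
    obtain ⟨r, hr, hzr⟩ := hball z0 hz0
    obtain ⟨C, hC, hCf⟩ := exists_norm_apply_le d hr
    have hin : ∀ z ∈ ball z0 r, ∀ y ∈ ball z (2 * r), ball y r ⊆ Ω := fun z hz y hy x hx => by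
      refine hzr ?_
      simp only [mem_ball] at *
      linarith [dist_triangle x y z0, dist_triangle y z z0]
    have hsub : ∀ z ∈ ball z0 r, ball z (2 * r) ⊆ Ω := fun z hz y hy =>
      hin z hz y hy (mem_ball_self hr)
    have hdat : ∀ (f : A2 Ω), ∀ z ∈ ball z0 r, DifferentiableAt ℂ f z := fun f z hz =>
      f.differentiableOn.differentiableAt
        (Ω.isOpen.mem_nhds (hsub z hz (mem_ball_self (by positivity))))
    have hder : ∀ m n, ∀ z ∈ ball z0 r,
        ‖fderiv ℂ (u m) z - fderiv ℂ (u n) z‖ ≤ C * ‖u m - u n‖ / r := by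
      intro m n z hz
      rw [← fderiv_sub (hdat _ z hz) (hdat _ z hz)]
      exact norm_fderiv_le (f := (u m - u n : A2 Ω)) hr
        ((u m - u n).differentiableOn.mono (hsub z hz))
        (fun y hy => hCf Ω (u m - u n) y (hin z hz y hy))
    have hUC : UniformCauchySeqOn (fun n => fderiv ℂ (u n)) atTop (ball z0 r) := by
      refine Metric.uniformCauchySeqOn_iff.2 fun ε hε => ?_
      obtain ⟨N, hN⟩ := hdist (ε * r / (C + 1)) (by positivity)
      refine ⟨N, fun m hm n hn z hz => ?_⟩
      have h2 := (lt_div_iff₀ (by positivity)).1 (hN m hm n hn)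
      rw [dist_eq_norm]
      refine (hder m n z hz).trans_lt ((div_lt_iff₀ hr).2 ?_)
      nlinarith [norm_nonneg (u m - u n)]
    have hlim : ∀ z, ∃ l, z ∈ ball z0 r → Tendsto (fun n => fderiv ℂ (u n) z) atTop (𝓝 l) := by
      intro z
      by_cases hz : z ∈ ball z0 r
      · obtain ⟨l, hl⟩ := cauchySeq_tendsto_of_complete (hUC.cauchySeq hz)
        exact ⟨l, fun _ => hl⟩
      · exact ⟨0, fun h => absurd h hz⟩
    choose g' hg' using hlim
    have hunif := hUC.tendstoUniformlyOn_of_tendsto (fun z hz => hg' z hz)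
    exact (hasFDerivAt_of_tendstoUniformlyOn isOpen_ball hunif
      (fun n z hz => (hdat (u n) z hz).hasFDerivAt) (fun z _ => hg z)
      (mem_ball_self hr)).differentiableAt.differentiableWithinAt
  -- the limit in `L²`
  have hL : CauchySeq (fun n => toL2 Ω (u n)) :=
    Metric.cauchySeq_iff.2 fun ε hε => by
      obtain ⟨N, hN⟩ := Metric.cauchySeq_iff.1 hu ε hε
      exact ⟨N, fun m hm n hn => hN m hm n hn⟩
  obtain ⟨F, hF⟩ := cauchySeq_tendsto_of_complete hL
  obtain ⟨ns, hns, hae⟩ := (tendstoInMeasure_of_tendsto_Lp hF).exists_seq_tendsto_ae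
  have hall : ∀ᵐ z ∂((V d).restrict Ω), ∀ n, toL2 Ω (u n) z = u n z :=
    ae_all_iff.2 fun n => (u n).memLp.coeFn_toLp
  have hFg : (F : CSpace d → ℂ) =ᵐ[(V d).restrict Ω] g := by
    filter_upwards [hae, hall] with z h1 h2
    simp only [h2] at h1
    exact tendsto_nhds_unique h1 ((hg z).comp hns.tendsto_atTop)
  have hgm : MemLp g 2 ((V d).restrict Ω) := (memLp_congr_ae hFg).1 (Lp.memLp F)
  let G : A2 Ω := ⟨g, hgdiff, hgm, fun z hz => by
    refine tendsto_nhds_unique (hg z) ?_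
    simp [eq_zero _ hz]⟩
  have hG : toL2 Ω G = F := by
    refine Lp.ext (hgm.coeFn_toLp.trans hFg.symm)
  refine ⟨G, Metric.tendsto_atTop.2 fun ε hε => ?_⟩
  obtain ⟨N, hN⟩ := Metric.tendsto_atTop.1 hF ε hε
  refine ⟨N, fun n hn => ?_⟩
  have h1 := hN n hn
  rw [← hG] at h1
  exact h1

instance : CompleteSpace (A2 Ω) :=
  Metric.complete_of_cauchySeq_tendsto tendsto_of_cauchySeq

end A2

/-- A holomorphic map-weight system on `Ω`, indexed by a (finite or countable) set `I`. -/
structure MapWeightSystem (Ω : Opens (CSpace d)) (I : Type*) where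
  φ : I → CSpace d → CSpace d
  w : I → A2 Ω
  holomorphic : ∀ i, DifferentiableOn ℂ (φ i) Ω
  compactlyContained : CompactlyContained (⋃ i, φ i '' Ω) (Ω : Set (CSpace d))
  summable_weights : eLpNorm (fun z => ∑' i, ‖w i z‖ₑ) 2 ((V d).restrict Ω) < ∞

namespace MapWeightSystem

variable {Ω : Opens (CSpace d)} {I : Type*} (S : MapWeightSystem Ω I)

theorem image_subset (i : I) : S.φ i '' Ω ⊆ closure (⋃ i, S.φ i '' Ω) :=
  (Set.subset_iUnion (fun i => S.φ i '' Ω) i).trans subset_closure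

theorem mapsTo (i : I) : Set.MapsTo (S.φ i) Ω Ω := fun _ hz =>
  S.compactlyContained.2 (S.image_subset i (Set.mem_image_of_mem _ hz))

open Classical in
/-- The weighted composition operator `M_w C_φ : f ↦ w · (f ∘ φ)` with `w = w_i`, `φ = φ_i`, as an
endomorphism of `A²(Ω)`. -/
def weightedComp (i : I) : A2 Ω →ₗ[ℂ] A2 Ω where
  toFun f := ⟨fun z => S.w i z * f (S.φ i z), by
    have hd : DifferentiableOn ℂ (fun z => f (S.φ i z)) Ω :=
      f.differentiableOn.comp (S.holomorphic i) (S.mapsTo i)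
    refine ⟨(S.w i).differentiableOn.mul hd, ?_, fun z hz => by simp [(S.w i).eq_zero hz]⟩
    obtain ⟨C, hC⟩ := S.compactlyContained.1.exists_bound_of_continuousOn
      (f.differentiableOn.continuousOn.mono S.compactlyContained.2)
    refine (S.w i).memLp.of_le_mul (c := C) ?_ ?_
    · exact (((S.w i).differentiableOn.mul hd).continuousOn).aestronglyMeasurable
        Ω.isOpen.measurableSet
    · refine ae_restrict_of_forall_mem Ω.isOpen.measurableSet fun z hz => ?_
      rw [norm_mul, mul_comm]
      exact mul_le_mul_of_nonneg_right (hC _ (S.image_subset i (Set.mem_image_of_mem _ hz)))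
        (norm_nonneg _)⟩
  map_add' f g := A2.ext fun z _ => mul_add _ _ _
  map_smul' c f := A2.ext fun z _ => mul_left_comm _ _ _

theorem weightedComp_apply (i : I) (f : A2 Ω) (z : CSpace d) :
    S.weightedComp i f z = S.w i z * f (S.φ i z) := rfl

/-- The bounded operator `L` on `A²(Ω)` is the transfer operator `∑ i, M_{w_i} C_{φ_i}` of the
system: the series converges to `L f` in `A²(Ω)` and pointwise in `Ω`, for every `f`. -/
structure IsTransferOperator (L : A2 Ω →L[ℂ] A2 Ω) : Prop where
  hasSum : ∀ f : A2 Ω, HasSum (fun i => S.weightedComp i f) (L f)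
  hasSum_apply : ∀ (f : A2 Ω), ∀ z ∈ Ω, HasSum (fun i => S.w i z * f (S.φ i z)) (L f z)

end MapWeightSystem

/-- `D` is strictly circled with centre `ζ`. -/
def StrictlyCircled (D : Set (CSpace d)) (ζ : CSpace d) : Prop :=
  ∀ μ : ℂ, ‖μ‖ < 1 →
    CompactlyContained ((fun z => μ • (z - ζ)) '' D) ((fun z => z - ζ) '' D)

/-- The dilate `D(r) = r (D - ζ) + ζ` of `D`, with respect to the centre `ζ`. -/
def dilate (D : Set (CSpace d)) (ζ : CSpace d) (r : ℝ) : Set (CSpace d) :=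
  (fun z => (r : ℂ) • (z - ζ) + ζ) '' D

/-- A relative cover of size `N` of the pair `(Ω₁, Ω₂)`, together with a scaling `γ`. -/
structure RelativeCover (Ω₁ Ω₂ : Set (CSpace d)) (N : ℕ) where
  size_pos : 0 < N
  D : Fin N → Set (CSpace d)
  centre : Fin N → CSpace d
  isOpen : ∀ n, IsOpen (D n)
  strictlyCircled : ∀ n, StrictlyCircled (D n) (centre n)
  subset_iUnion : Ω₂ ⊆ ⋃ n, D n
  γ : Fin N → ℝ
  one_lt_γ : ∀ n, 1 < γ n
  iUnion_dilate_subset : ⋃ n, dilate (D n) (centre n) (γ n) ⊆ Ω₁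

/-- The efficiency `Γ = (log γ₁, …, log γ_N)`. -/
def RelativeCover.efficiency {Ω₁ Ω₂ : Set (CSpace d)} {N : ℕ} (R : RelativeCover Ω₁ Ω₂ N) :
    Fin N → ℝ :=
  fun n => Real.log (R.γ n)

end BergmanSpace

/-- `‖(x₁, …, x_N)‖_d = (∑ |x_j|^{-d})^{-1/d}`. -/
def gaugeNorm (d : ℕ) {N : ℕ} (x : Fin N → ℝ) : ℝ :=
  (∑ j, |x j| ^ (-(d : ℝ))) ^ (-(1 / (d : ℝ)))

/-- The distance `inf {|a - b| : a ∈ A, b ∈ B}` between two sets. -/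
def setDist {X : Type*} [PseudoMetricSpace X] (A B : Set X) : ℝ :=
  sInf (Set.image2 dist A B)

section Eigenvalues

variable {H : Type*} [NormedAddCommGroup H] [InnerProductSpace ℂ H]

/-- `lam` is an eigenvalue sequence of `A` (a compact operator): the moduli are decreasing and each
nonzero `μ` occurs as often as its algebraic multiplicity as an eigenvalue of `A` (zero times if it
is none); if `A` has only finitely many nonzero eigenvalues, the sequence continues with zeros.
Sequences are indexed from `0`, so that `lam n` is the eigenvalue number `n + 1`. -/
structure IsEigenvalueSequence (A : H →L[ℂ] H) (lam : ℕ → ℂ) : Prop where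
  antitone : Antitone fun n => ‖lam n‖
  multiplicity : ∀ μ : ℂ, μ ≠ 0 → {n | lam n = μ}.encard =
    Cardinal.toENat (Module.rank ℂ (Module.End.maxGenEigenspace (A : Module.End ℂ H) μ))

/-- An eigenvalue sequence of `A`, for `A` compact. -/
def eigenvalues (A : H →L[ℂ] H) : ℕ → ℂ := Classical.epsilon (IsEigenvalueSequence A)

/-- The singular values `s_{n+1}(A) = √(λ_{n+1}(A* A))` of a compact operator `A` (indexed from
`0`). -/
def singularValue [CompleteSpace H] {K : Type*} [NormedAddCommGroup K] [InnerProductSpace ℂ K]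
    [CompleteSpace K] (A : H →L[ℂ] K) (n : ℕ) : ℝ :=
  Real.sqrt (eigenvalues ((ContinuousLinearMap.adjoint A).comp A) n).re

/-- The gauge `|x|_{a,α} = sup_{n ≥ 1} |x_n| exp(a n^α)` of a sequence, whose entry number `n + 1`
is `x n`. -/
def seqGauge (a α : ℝ) (x : ℕ → ℂ) : ℝ≥0∞ :=
  ⨆ n : ℕ, ENNReal.ofReal (‖x n‖ * Real.exp (a * ((n : ℝ) + 1) ^ α))

/-- The class `𝓔(a, α)` of sequences. -/
def seqClass (a α : ℝ) : Set (ℕ → ℂ) := {x | seqGauge a α x < ∞}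

/-- The gauge `|A|_{a,α} = sup_{n ≥ 1} s_n(A) exp(a n^α)` of a compact operator. -/
def opGauge [CompleteSpace H] {K : Type*} [NormedAddCommGroup K] [InnerProductSpace ℂ K]
    [CompleteSpace K] (a α : ℝ) (A : H →L[ℂ] K) : ℝ≥0∞ :=
  seqGauge a α fun n => (singularValue A n : ℂ)

/-- The exponential class `E(a, α)` of operators. -/
def expClass [CompleteSpace H] {K : Type*} [NormedAddCommGroup K] [InnerProductSpace ℂ K]
    [CompleteSpace K] (a α : ℝ) : Set (H →L[ℂ] K) :=
  {A | IsCompactOperator A ∧ opGauge a α A < ∞}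

end Eigenvalues

end Bergman

end

noncomputable section

namespace Bergman

/-! ### Partial derivatives of holomorphic functions and vanishing conditions at a point. -/

section SeveralComplexVariables

variable {d : ℕ}

/-! The transfer operator sees `f` only through its values at the points `φ i z`, which lie in `Ωt`
at distance at least `r_i` from its frontier. As `V` gives the unit ball mass one, the mean value
property for `f ^ 2` bounds such a value by `r_i^{-d}` times the norm of `f` in `L²(Ωt)`. Hence `‖L
f‖ ≤ W ‖f‖_{L²(Ωt)}`, where `W` is the `L²(Ω)` norm of `∑ |w_i| r_i^{-d}`
(`MapWeightSystem.exists_isTransferOperator`). It remains to see how small the restriction to `Ωt`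
is on subspaces of finite codimension.

Let `f` vanish to order `k` at the centre of a circled `D` whose dilate `D(γ)` lies in `Ω`. On each
complex line through the centre, Parseval's identity makes the quadratic mean over circles grow by
at least `γ^{2k}` under dilation, and the Jacobian contributes `γ^{2d}`; so `‖f‖_D ≤ γ^{-(k+d)}
‖f‖_Ω` (`StrictlyCircled.pow_mul_lintegral_le`). Vanishing to order `k` costs `binom (k+d-1) d`
linear conditions, at most `(k + (d-1)/2)^d` when `k ≥ 1`. With `k_j` equal to `c n^{1/d} / Γ_j -
(d+1)/2` rounded up, fewer than `n` conditions are used in all, because `c^d ∑ Γ_j^{-d} = 1`, and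
each `D_j` contributes at most the factor `exp (-c n^{1/d} - (d-1) Γ_j / 2)`
(`RelativeCover.exists_functionals`).

`KernelBound` links this to spectral theory: the singular value of index `n` (counted from `0`) is
the least nonnegative bound of the operator on a subspace of codimension at most `n`. For the
eigenvalues, let `E` be the sum of the generalised eigenspaces with `|μ| ≥ |λ_n|` and `k` its
dimension. The determinant of `L` on `E` has modulus at least `|λ_n|^k` and at most the product of
the first `k` singular values (Weyl), and `∑_{i ≤ k} i^{1/d} ≥ d/(d+1) k^{1+1/d}` gives the rate
`dc/(1+d)`. The same determinant estimate shows beforehand that such sums are finite-dimensional, so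
that eigenvalue sequences exist. -/

theorem lineMap_mem_ball {z v : CSpace d} {s ρ : ℝ} {ζ : ℂ} (hζ : ‖ζ‖ ≤ s) (hρ : s * ‖v‖ < ρ) :
    z + ζ • v ∈ ball z ρ := by
  rw [mem_ball, dist_self_add_left, norm_smul]
  exact (mul_le_mul_of_nonneg_right hζ (norm_nonneg v)).trans_lt hρ

/-- Directional derivatives of holomorphic functions are holomorphic. -/
theorem differentiableOn_fderiv_apply {f : CSpace d → ℂ} {U : Set (CSpace d)} (hU : IsOpen U)
    (hf : DifferentiableOn ℂ f U) (v : CSpace d) :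
    DifferentiableOn ℂ (fun z => fderiv ℂ f z v) U := by
  intro z₀ hz₀
  obtain ⟨ε₁, hε₁, hsub⟩ := Metric.isOpen_iff.1 hU z₀ hz₀
  obtain ⟨ε₂, hε₂, hbd⟩ := Metric.continuousAt_iff.1
    (hf.differentiableAt (hU.mem_nhds hz₀)).continuousAt 1 one_pos
  -- Base points range over radius `ρ`, the circles through them stay within `2ρ`, and the Cauchy
  -- estimate for the derivative there needs a further `2ρ`; hence the factor `4`.
  obtain ⟨ρ, hρ, hρ₁, hρ₂⟩ : ∃ ρ : ℝ, 0 < ρ ∧ 4 * ρ ≤ ε₁ ∧ 4 * ρ ≤ ε₂ :=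
    ⟨min ε₁ ε₂ / 4, by positivity, by linarith [min_le_left ε₁ ε₂], by linarith [min_le_right ε₁ ε₂]⟩
  set M : ℝ := ‖f z₀‖ + 1
  have hM : ∀ y ∈ ball z₀ (4 * ρ), ‖f y‖ ≤ M := fun y hy => by
    have h1 := (hbd (lt_of_lt_of_le hy hρ₂)).le
    rw [dist_eq_norm] at h1
    linarith [norm_le_norm_add_norm_sub' (f y) (f z₀)]
  have hd4 : DifferentiableOn ℂ f (ball z₀ (4 * ρ)) :=
    hf.mono ((ball_subset_ball hρ₁).trans hsub)
  -- The `+ 1` in the witness covers `v = 0`.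
  obtain ⟨s, hs, hsv⟩ : ∃ s : ℝ, 0 < s ∧ s * ‖v‖ < ρ :=
    ⟨ρ / (‖v‖ + 1), by positivity, by
      rw [div_mul_eq_mul_div, div_lt_iff₀ (by positivity)]; nlinarith [norm_nonneg v]⟩
  have hmem : ∀ z ∈ ball z₀ ρ, ∀ ζ : ℂ, ‖ζ‖ ≤ s → z + ζ • v ∈ ball z₀ (2 * ρ) := fun z hz ζ hζ => by
    have h1 := mem_ball.1 (lineMap_mem_ball (z := z) hζ hsv)
    have h2 := mem_ball.1 hz
    rw [mem_ball]
    linarith [dist_triangle (z + ζ • v) z z₀]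
  set c : ℝ → ℂ := fun θ => deriv (circleMap 0 s) θ * ((circleMap 0 s θ - 0) ^ 2)⁻¹ with hc
  have hcne : ∀ θ, circleMap 0 s θ ≠ 0 := fun θ => circleMap_ne_center hs.ne'
  have hcc : Continuous c := by
    simp only [hc, deriv_circleMap, sub_zero]
    exact ((continuous_circleMap 0 s).mul continuous_const).mul
      (((continuous_circleMap 0 s).pow 2).inv₀ fun θ => pow_ne_zero 2 (hcne θ))
  have hcm : ∀ θ, ‖circleMap 0 s θ‖ ≤ s := fun θ => by simp [abs_of_pos hs]
  -- Cauchy's formula for the derivative along the line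
  have hcauchy : ∀ z ∈ ball z₀ ρ, fderiv ℂ f z v =
      (2 * Real.pi * Complex.I : ℂ)⁻¹ • ∫ θ in 0..2 * Real.pi, c θ * f (z + circleMap 0 s θ • v) := by
    intro z hz
    set O : Set ℂ := {ζ | z + ζ • v ∈ ball z₀ (2 * ρ)}
    have hO : IsOpen O := isOpen_ball.preimage (by fun_prop)
    have hdO : DifferentiableOn ℂ (fun ζ : ℂ => f (z + ζ • v)) O :=
      (hd4.mono (ball_subset_ball (by linarith))).comp (by fun_prop) fun ζ hζ => hζ
    have h1 := Complex.cderiv_eq_deriv (r := s) hO hdO hs (z := 0) fun ζ hζ =>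
      hmem z hz ζ (by simpa using hζ)
    have h2 : HasDerivAt (fun ζ : ℂ => f (z + ζ • v)) (fderiv ℂ f z v) 0 := by
      have h3 : HasFDerivAt f (fderiv ℂ f z) z :=
        (hd4.differentiableAt (isOpen_ball.mem_nhds
          (ball_subset_ball (by linarith) hz))).hasFDerivAt
      have h4 : HasDerivAt (fun ζ : ℂ => z + ζ • v) v 0 := by
        simpa using ((hasDerivAt_id (0 : ℂ)).smul_const v).const_add z
      exact HasFDerivAt.comp_hasDerivAt (0 : ℂ) (by simpa using h3) h4
    rw [← h2.deriv, ← h1, Complex.cderiv, circleIntegral]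
    simp only [smul_eq_mul, hc, mul_assoc]
  have hda : ∀ z ∈ ball z₀ (2 * ρ), DifferentiableAt ℂ f z := fun z hz =>
    hd4.differentiableAt (isOpen_ball.mem_nhds (ball_subset_ball (by linarith) hz))
  have hfd : ∀ z ∈ ball z₀ (2 * ρ), ‖fderiv ℂ f z‖ ≤ M / ρ := fun z hz => by
    have hsub2 : ball z (2 * ρ) ⊆ ball z₀ (4 * ρ) := ball_subset_ball' (by
      linarith [mem_ball.1 hz])
    exact A2.norm_fderiv_le hρ (hd4.mono hsub2) fun y hy => hM y (hsub2 hy)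
  have hM0 : 0 ≤ M := by positivity
  have hcontF : ∀ z ∈ ball z₀ ρ, Continuous fun θ => c θ * f (z + circleMap 0 s θ • v) := by
    intro z hz
    refine hcc.mul ?_
    refine continuous_iff_continuousAt.2 fun θ => ?_
    have h1 : ContinuousAt f (z + circleMap 0 s θ • v) := (hda _ (hmem z hz _ (hcm θ))).continuousAt
    exact ContinuousAt.comp (f := fun θ => z + circleMap 0 s θ • v) h1 (by fun_prop)
  -- Cauchy's formula writes the directional derivative as an integral in which `z` enters only
  -- through `f`, so differentiating under the integral sign needs just one derivative of `f`.
  have hint := intervalIntegral.hasFDerivAt_integral_of_dominated_of_fderiv_le (𝕜 := ℂ)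
    (μ := volume) (a := 0) (b := 2 * Real.pi)
    (F := fun z θ => c θ * f (z + circleMap 0 s θ • v))
    (F' := fun z θ => c θ • fderiv ℂ f (z + circleMap 0 s θ • v)) (x₀ := z₀)
    (bound := fun θ => ‖c θ‖ * (M / ρ)) (ball_mem_nhds z₀ hρ)
    ((eventually_of_mem (ball_mem_nhds z₀ hρ)) fun z hz => (hcontF z hz).aestronglyMeasurable)
    ((hcontF z₀ (mem_ball_self hρ)).intervalIntegrable _ _)
    (by
      -- Continuity of the derivative has not been established here; measurability suffices.
      have h1 : Measurable fun θ => fderiv ℂ f (z₀ + circleMap 0 s θ • v) :=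
        (measurable_fderiv ℂ f).comp (by fun_prop)
      exact (hcc.measurable.smul h1).aestronglyMeasurable)
    (ae_of_all _ fun θ _ z hz => by
      rw [norm_smul]
      exact mul_le_mul_of_nonneg_left (hfd _ (hmem z hz _ (hcm θ))) (norm_nonneg _))
    ((hcc.norm.mul continuous_const).intervalIntegrable _ _)
    (ae_of_all _ fun θ _ z hz => by
      have h1 := (hda _ (hmem z hz _ (hcm θ))).hasFDerivAt
      have h2 : HasFDerivAt (fun z => f (z + circleMap 0 s θ • v))
          (fderiv ℂ f (z + circleMap 0 s θ • v)) z := by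
        have h3 := h1.comp z ((hasFDerivAt_id (𝕜 := ℂ) z).add_const (circleMap 0 s θ • v))
        rw [ContinuousLinearMap.comp_id] at h3
        exact h3
      simpa using h2.const_mul (c θ))
  have h5 := hint.differentiableAt.const_smul ((2 * Real.pi * Complex.I : ℂ)⁻¹)
  refine (h5.congr_of_eventuallyEq ?_).differentiableWithinAt
  exact eventually_of_mem (ball_mem_nhds z₀ hρ) fun z hz => hcauchy z hz

/-- Holomorphic functions have symmetric second derivatives. -/
theorem fderiv_fderiv_apply_comm {f : CSpace d → ℂ} {U : Set (CSpace d)} (hU : IsOpen U)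
    (hf : DifferentiableOn ℂ f U) (v w : CSpace d) {z : CSpace d} (hz : z ∈ U) :
    fderiv ℂ (fun y => fderiv ℂ f y v) z w = fderiv ℂ (fun y => fderiv ℂ f y w) z v := by
  -- The derivative is a finite combination of coordinate functionals with holomorphic coefficients,
  -- so it is itself differentiable and the general symmetry theorem applies.
  have hrep : ∀ y, fderiv ℂ f y = ∑ i : Fin d, (fderiv ℂ f y (EuclideanSpace.single i 1)) •
      (EuclideanSpace.proj i : CSpace d →L[ℂ] ℂ) := fun y => by
    ext x
    have hx : x = ∑ i : Fin d, x i • EuclideanSpace.single i (1 : ℂ) := by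
      ext j
      simp [Finset.sum_apply, Pi.single_apply]
    conv_lhs => rw [hx]
    simp [mul_comm]
  have hdd : DifferentiableAt ℂ (fderiv ℂ f) z := by
    have h1 : DifferentiableAt ℂ (fun y => ∑ i : Fin d,
        (fderiv ℂ f y (EuclideanSpace.single i 1)) •
          (EuclideanSpace.proj i : CSpace d →L[ℂ] ℂ)) z :=
      DifferentiableAt.fun_sum fun i _ => ((differentiableOn_fderiv_apply hU hf _).differentiableAt
        (hU.mem_nhds hz)).smul_const _
    rwa [← funext hrep] at h1
  have hsymm := second_derivative_symmetric_of_eventually (f := f) (f' := fderiv ℂ f)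
    (f'' := fderiv ℂ (fderiv ℂ f) z) (x := z)
    (eventually_of_mem (hU.mem_nhds hz) fun y hy =>
      (hf.differentiableAt (hU.mem_nhds hy)).hasFDerivAt) hdd.hasFDerivAt w v
  have h2 : ∀ u t : CSpace d, fderiv ℂ (fun y => fderiv ℂ f y u) z t =
      fderiv ℂ (fderiv ℂ f) z t u := fun u t => by
    rw [fderiv_clm_apply hdd (differentiableAt_const u)]
    simp
  rw [h2, h2, hsymm]

/-- The iterated partial derivative along a list of coordinates. -/
def partialDeriv : List (Fin d) → (CSpace d → ℂ) → CSpace d → ℂ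
  | [], f => f
  | i :: l, f => partialDeriv l fun z => fderiv ℂ f z (EuclideanSpace.single i 1)

theorem partialDeriv_congr {U : Set (CSpace d)} (hU : IsOpen U) (l : List (Fin d)) :
    ∀ {f g : CSpace d → ℂ}, Set.EqOn f g U → Set.EqOn (partialDeriv l f) (partialDeriv l g) U := by
  induction l with
  | nil => exact fun h => h
  | cons i l ih =>
    intro f g h
    refine ih fun z hz => ?_
    simp only [(h.eventuallyEq_of_mem (hU.mem_nhds hz)).fderiv_eq]

/-- Adjacent transpositions generate all permutations, and each is the symmetry of a second
derivative. Partial derivatives may thus be indexed by multisets, which makes the count of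
conditions sharp enough. -/
theorem partialDeriv_perm {U : Set (CSpace d)} (hU : IsOpen U) {l l' : List (Fin d)}
    (h : l.Perm l') : ∀ {f : CSpace d → ℂ}, DifferentiableOn ℂ f U →
      Set.EqOn (partialDeriv l f) (partialDeriv l' f) U := by
  induction h with
  | nil => exact fun _ _ _ => rfl
  | cons i _ ih => exact fun hf => ih (differentiableOn_fderiv_apply hU hf _)
  | swap i j l =>
    exact fun hf => partialDeriv_congr hU l fun z hz => fderiv_fderiv_apply_comm hU hf _ _ hz
  | trans _ _ ih₁ ih₂ => exact fun hf => (ih₁ hf).trans (ih₂ hf)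

theorem partialDeriv_add {U : Set (CSpace d)} (hU : IsOpen U) (l : List (Fin d)) :
    ∀ {f g : CSpace d → ℂ}, DifferentiableOn ℂ f U → DifferentiableOn ℂ g U →
      Set.EqOn (partialDeriv l (f + g)) (partialDeriv l f + partialDeriv l g) U := by
  induction l with
  | nil => exact fun _ _ _ _ => rfl
  | cons i l ih =>
    intro f g hf hg
    refine Set.EqOn.trans (partialDeriv_congr hU l fun z hz => ?_)
      (ih (differentiableOn_fderiv_apply hU hf _) (differentiableOn_fderiv_apply hU hg _))
    simp [fderiv_add (hf.differentiableAt (hU.mem_nhds hz))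
      (hg.differentiableAt (hU.mem_nhds hz))]

theorem partialDeriv_smul {U : Set (CSpace d)} (hU : IsOpen U) (l : List (Fin d)) (c : ℂ) :
    ∀ {f : CSpace d → ℂ}, DifferentiableOn ℂ f U →
      Set.EqOn (partialDeriv l (c • f)) (c • partialDeriv l f) U := by
  induction l with
  | nil => exact fun _ _ _ => rfl
  | cons i l ih =>
    intro f hf
    refine Set.EqOn.trans (partialDeriv_congr hU l fun z hz => ?_)
      (ih (differentiableOn_fderiv_apply hU hf _))
    simp [fderiv_const_smul (hf.differentiableAt (hU.mem_nhds hz))]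

theorem hasDerivAt_line {f : CSpace d → ℂ} {ζ v : CSpace d} {t : ℂ}
    (hf : DifferentiableAt ℂ f (ζ + t • v)) :
    HasDerivAt (fun t : ℂ => f (ζ + t • v))
      (∑ i, v i * fderiv ℂ f (ζ + t • v) (EuclideanSpace.single i 1)) t := by
  have h4 : HasDerivAt (fun t : ℂ => ζ + t • v) v t := by
    simpa using ((hasDerivAt_id t).smul_const v).const_add ζ
  have h5 := HasFDerivAt.comp_hasDerivAt t hf.hasFDerivAt h4
  have hv : fderiv ℂ f (ζ + t • v) v =
      ∑ i, v i * fderiv ℂ f (ζ + t • v) (EuclideanSpace.single i 1) := by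
    have hx : v = ∑ i : Fin d, v i • EuclideanSpace.single i (1 : ℂ) := by
      ext j
      simp [Finset.sum_apply, Pi.single_apply]
    generalize fderiv ℂ f (ζ + t • v) = L
    conv_lhs => rw [hx, map_sum]
    simp
  rw [← hv]
  exact h5

/-- If the partial derivatives of order `j` vanish at a point, so do the derivatives of order `j`
along the complex lines through this point. -/
theorem iteratedDeriv_line_eq_zero {U : Set (CSpace d)} (hU : IsOpen U) {ζ : CSpace d} (hζ : ζ ∈ U)
    (v : CSpace d) (j : ℕ) : ∀ {f : CSpace d → ℂ}, DifferentiableOn ℂ f U →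
      (∀ l : List (Fin d), l.length = j → partialDeriv l f ζ = 0) →
      iteratedDeriv j (fun t : ℂ => f (ζ + t • v)) 0 = 0 := by
  have hO : IsOpen {t : ℂ | ζ + t • v ∈ U} := hU.preimage (by fun_prop)
  have h0 : (0 : ℂ) ∈ {t : ℂ | ζ + t • v ∈ U} := by simpa using hζ
  induction j with
  | zero => intro f _ h; simpa [partialDeriv] using h [] rfl
  | succ j ih =>
    intro f hf h
    have h1 : deriv (fun t : ℂ => f (ζ + t • v)) =ᶠ[𝓝 0]
        fun t => ∑ i, v i * fderiv ℂ f (ζ + t • v) (EuclideanSpace.single i 1) :=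
      eventually_of_mem (hO.mem_nhds h0) fun t ht =>
        (hasDerivAt_line (hf.differentiableAt (hU.mem_nhds ht))).deriv
    have h2 : ∀ i : Fin d, ContDiffAt ℂ j (fun t : ℂ => v i * fderiv ℂ f (ζ + t • v)
        (EuclideanSpace.single i 1)) 0 := fun i => by
      have h3 : DifferentiableOn ℂ (fun t : ℂ => v i * fderiv ℂ f (ζ + t • v)
          (EuclideanSpace.single i 1)) {t : ℂ | ζ + t • v ∈ U} :=
        (DifferentiableOn.comp (differentiableOn_fderiv_apply hU hf (EuclideanSpace.single i 1))
          (f := fun t : ℂ => ζ + t • v) (by fun_prop) fun t ht => ht).const_mul (v i)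
      exact (h3.contDiffOn hO).contDiffAt (hO.mem_nhds h0)
    rw [iteratedDeriv_succ', h1.iteratedDeriv_eq]
    rw [show (fun t : ℂ => ∑ i, v i * fderiv ℂ f (ζ + t • v) (EuclideanSpace.single i 1)) =
      fun t : ℂ => ∑ i, (fun i t => v i * fderiv ℂ f (ζ + t • v) (EuclideanSpace.single i 1)) i t
      from rfl, iteratedDeriv_fun_sum fun i _ => h2 i]
    -- One derivative along the line produces first partials of `f`, whose order-`j` partials are
    -- order-`(j+1)` partials of `f`; the induction runs over all functions.
    refine Finset.sum_eq_zero fun i _ => ?_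
    rw [iteratedDeriv_const_mul_field, ih (differentiableOn_fderiv_apply hU hf _)
      fun l hl => h (i :: l) (by simp [hl]), mul_zero]

/-- The hockey-stick identity: it counts the monomials of degree less than `k` in `d` variables. -/
theorem sum_multichoose_range {d : ℕ} (hd : 0 < d) (k : ℕ) :
    ∑ j ∈ Finset.range k, d.multichoose j = (k + d - 1).choose d := by
  obtain ⟨e, rfl⟩ : ∃ e, d = e + 1 := ⟨d - 1, by omega⟩
  induction k with
  | zero => simp
  | succ k ih =>
    rw [Finset.sum_range_succ, ih, Nat.multichoose_eq]
    have h1 : e + 1 + k - 1 = k + e := by omega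
    have h2 : k + (e + 1) - 1 = k + e := by omega
    have h3 : k + 1 + (e + 1) - 1 = (k + e) + 1 := by omega
    rw [h1, h2, h3, Nat.choose_succ_succ, add_comm, Nat.choose_symm_add]

/-- Vanishing to order `k` at a point amounts to `binom (k + d - 1) d` linear conditions. -/
theorem exists_vanishing_functionals (hd : 0 < d) {Ω : Opens (CSpace d)} {ζ : CSpace d}
    (hζ : ζ ∈ Ω) (k : ℕ) :
    ∃ Λ : A2 Ω →ₗ[ℂ] (Fin ((k + d - 1).choose d) → ℂ), ∀ f, Λ f = 0 →
      ∀ v, ∀ j < k, iteratedDeriv j (fun t : ℂ => f (ζ + t • v)) 0 = 0 := by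
  have hcard : Fintype.card (Σ j : Fin k, Sym (Fin d) j) = (k + d - 1).choose d := by
    rw [Fintype.card_sigma, ← sum_multichoose_range hd k, ← Fin.sum_univ_eq_sum_range]
    simp [Sym.card_sym_eq_multichoose]
  let e : Fin ((k + d - 1).choose d) ≃ Σ j : Fin k, Sym (Fin d) j :=
    (finCongr hcard.symm).trans (Fintype.equivFin _).symm
  let Λ : A2 Ω →ₗ[ℂ] (Fin ((k + d - 1).choose d) → ℂ) :=
    { toFun := fun f n => partialDeriv (e n).2.1.toList f ζ
      map_add' := fun f g => funext fun n =>
        partialDeriv_add Ω.isOpen _ f.differentiableOn g.differentiableOn hζ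
      map_smul' := fun c f => funext fun n =>
        partialDeriv_smul Ω.isOpen _ c f.differentiableOn hζ }
  refine ⟨Λ, fun f hf v j hj => iteratedDeriv_line_eq_zero Ω.isOpen hζ v j f.differentiableOn ?_⟩
  intro l hl
  let s : Sym (Fin d) j := ⟨(l : Multiset (Fin d)), by simpa using hl⟩
  have h1 : partialDeriv (e (e.symm ⟨⟨j, hj⟩, s⟩)).2.1.toList f ζ = 0 :=
    congrFun hf (e.symm ⟨⟨j, hj⟩, s⟩)
  rw [e.apply_symm_apply] at h1
  -- `Λ` records one chosen ordering of each multiset; every other ordering gives the same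
  -- derivative.
  have hperm : l.Perm (s.1.toList) := by
    rw [← Multiset.coe_eq_coe, Multiset.coe_toList]
  rw [partialDeriv_perm Ω.isOpen hperm f.differentiableOn hζ]
  exact h1

end SeveralComplexVariables

/-! ### Decay on circled domains of functions vanishing at the centre. -/

section CircledDomains

open Polynomial in
/-- Parseval's identity on circles. -/
theorem tendsto_sum_sq_taylor {g : ℂ → ℂ} {R ρ : ℝ} (hg : DifferentiableOn ℂ g (ball 0 R))
    (hρ : 0 ≤ ρ) (hρR : ρ < R) :
    Tendsto (fun n => ∑ j ∈ Finset.range n, ‖(j.factorial : ℂ)⁻¹ * iteratedDeriv j g 0‖ ^ 2 *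
      ρ ^ (2 * j)) atTop
      (𝓝 ((2 * Real.pi)⁻¹ * ∫ θ in 0..2 * Real.pi, ‖g (circleMap 0 ρ θ)‖ ^ 2)) := by
  set a : ℕ → ℂ := fun j => (j.factorial : ℂ)⁻¹ * iteratedDeriv j g 0 with ha
  have hsum : ∀ z ∈ ball (0 : ℂ) R, HasSum (fun n => a n * z ^ n) (g z) := fun z hz => by
    have h1 := Complex.hasSum_taylorSeries_on_ball hg hz
    simp only [smul_eq_mul, sub_zero] at h1
    refine h1.congr_fun fun n => ?_
    simp only [ha]; ring
  have hρmem : ∀ θ, circleMap 0 ρ θ ∈ ball (0 : ℂ) R := fun θ => by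
    simpa [abs_of_nonneg hρ] using hρR
  have hsn : Summable fun n => ‖a n‖ * ρ ^ n := by
    have h1 := (hsum (ρ : ℂ) (by simpa [abs_of_nonneg hρ] using hρR)).summable.norm
    simpa [norm_mul, norm_pow, abs_of_nonneg hρ] using h1
  set B : ℝ := ∑' n, ‖a n‖ * ρ ^ n
  have hpar : ∀ n, ∑ j ∈ Finset.range n, ‖a j‖ ^ 2 * ρ ^ (2 * j) = (2 * Real.pi)⁻¹ *
      ∫ θ in 0..2 * Real.pi, ‖∑ j ∈ Finset.range n, a j * circleMap 0 ρ θ ^ j‖ ^ 2 := by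
    intro n
    -- The factor `ρ ^ j` in the coefficients moves the circle of radius `ρ` to the unit circle,
    -- where Parseval for polynomials applies.
    set q : ℂ[X] := ∑ j ∈ Finset.range n, monomial j (a j * ρ ^ j) with hq
    have hcoeff : ∀ j, q.coeff j = if j ∈ Finset.range n then a j * ρ ^ j else 0 := fun j => by
      simp only [hq, finsetSum_coeff, coeff_monomial]
      rw [Finset.sum_ite_eq']
    have h1 := q.sum_sq_norm_coeff_eq_circleAverage
    have h2 : ∑ j ∈ q.support, ‖q.coeff j‖ ^ 2 = ∑ j ∈ Finset.range n, ‖q.coeff j‖ ^ 2 := by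
      refine Finset.sum_subset (fun j hj => ?_) fun j _ hj => ?_
      · by_contra hjn
        rw [mem_support_iff, hcoeff, if_neg hjn] at hj
        exact hj rfl
      · rw [notMem_support_iff.1 hj]; simp
    rw [h2, Real.circleAverage_def, smul_eq_mul] at h1
    have h3 : ∀ θ, q.eval (circleMap 0 1 θ) = ∑ j ∈ Finset.range n, a j * circleMap 0 ρ θ ^ j := by
      intro θ
      simp only [hq, eval_finsetSum, eval_monomial]
      refine Finset.sum_congr rfl fun j _ => ?_
      simp only [circleMap, zero_add, Complex.ofReal_one, one_mul]
      ring
    simp only [h3] at h1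
    rw [← h1]
    refine Finset.sum_congr rfl fun j hj => ?_
    rw [hcoeff, if_pos hj, norm_mul (a j), norm_pow, Complex.norm_real, Real.norm_of_nonneg hρ]
    ring
  refine Tendsto.congr (fun n => (hpar n).symm) ?_
  refine Tendsto.const_mul _ ?_
  have hcircle : ∀ θ, ‖circleMap 0 ρ θ‖ = ρ := fun θ => by simp [abs_of_nonneg hρ]
  refine intervalIntegral.tendsto_integral_filter_of_dominated_convergence (fun _ => B ^ 2)
    (Eventually.of_forall fun n => ?_) (Eventually.of_forall fun n => ae_of_all _ fun θ _ => ?_)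
    intervalIntegrable_const (ae_of_all _ fun θ _ => ?_)
  · refine Continuous.aestronglyMeasurable ?_
    fun_prop
  · rw [Real.norm_of_nonneg (by positivity)]
    refine pow_le_pow_left₀ (norm_nonneg _) ?_ 2
    refine (norm_sum_le _ _).trans ?_
    simp only [norm_mul, norm_pow, hcircle]
    exact hsn.sum_le_tsum _ fun j _ => by positivity
  · exact ((hsum _ (hρmem θ)).tendsto_sum_nat.norm).pow 2

/-- Growth of the quadratic means of a function vanishing to order `k`. -/
theorem pow_mul_integral_circle_le {g : ℂ → ℂ} {R γ : ℝ} (hγ : 1 ≤ γ) (hγR : γ < R)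
    (hg : DifferentiableOn ℂ g (ball 0 R)) {k : ℕ} (hk : ∀ j < k, iteratedDeriv j g 0 = 0) :
    γ ^ (2 * k) * ∫ θ in 0..2 * Real.pi, ‖g (circleMap 0 1 θ)‖ ^ 2 ≤
      ∫ θ in 0..2 * Real.pi, ‖g (circleMap 0 γ θ)‖ ^ 2 := by
  have h1 := (tendsto_sum_sq_taylor hg zero_le_one (hγ.trans_lt hγR)).const_mul (γ ^ (2 * k))
  have h2 := tendsto_sum_sq_taylor hg (zero_le_one.trans hγ) hγR
  -- Termwise comparison of Taylor sums: terms with `j < k` vanish, and `γ^{2k} ≤ γ^{2j}` for the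
  -- others.
  have h3 := le_of_tendsto_of_tendsto' h1 h2 fun n => by
    rw [Finset.mul_sum]
    refine Finset.sum_le_sum fun j _ => ?_
    rcases lt_or_ge j k with hj | hj
    · simp [hk j hj]
    · rw [one_pow, mul_one, mul_comm]
      exact mul_le_mul_of_nonneg_left (pow_le_pow_right₀ hγ (by omega)) (by positivity)
  rw [mul_left_comm] at h3
  exact le_of_mul_le_mul_left h3 (by positivity)

theorem lintegral_circle_eq_ofReal {g : ℂ → ℂ} {R ρ : ℝ} (hρ : 0 ≤ ρ) (hρR : ρ < R)
    (hg : DifferentiableOn ℂ g (ball 0 R)) :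
    ∫⁻ θ in Set.Ioc 0 (2 * Real.pi), ‖g (circleMap 0 ρ θ)‖ₑ ^ 2 =
      ENNReal.ofReal (∫ θ in 0..2 * Real.pi, ‖g (circleMap 0 ρ θ)‖ ^ 2) := by
  have hcont : Continuous fun θ => ‖g (circleMap 0 ρ θ)‖ ^ 2 := by
    refine (Continuous.norm ?_).pow 2
    refine hg.continuousOn.comp_continuous (continuous_circleMap 0 ρ) fun θ => ?_
    simpa [abs_of_nonneg hρ] using hρR
  rw [intervalIntegral.integral_of_le (by positivity),
    ofReal_integral_eq_lintegral_ofReal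
      ((hcont.intervalIntegrable 0 (2 * Real.pi)).1) (ae_of_all _ fun _ => by positivity)]
  refine lintegral_congr fun θ => ?_
  rw [← ofReal_norm, ENNReal.ofReal_pow (norm_nonneg _)]

variable {d : ℕ}

theorem finrank_real_CSpace : Module.finrank ℝ (CSpace d) = 2 * d := by
  rw [finrank_real_of_complex, finrank_euclideanSpace_fin]

/-- Rotation invariance of integrals over circled sets. -/
theorem setLIntegral_circle_smul {A : Set (CSpace d)} (hA : MeasurableSet A)
    (hc : ∀ μ : ℂ, ‖μ‖ = 1 → ∀ v ∈ A, μ • v ∈ A) {F : CSpace d → ℝ≥0∞} (hF : Measurable F)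
    {c : ℂ} (hc1 : ‖c‖ = 1) : ∫⁻ v in A, F (c • v) ∂(V d) = ∫⁻ v in A, F v ∂(V d) := by
  have hc0 : c ≠ 0 := by rw [← norm_ne_zero_iff, hc1]; exact one_ne_zero
  let e : CSpace d ≃ₗᵢ[ℝ] CSpace d :=
    { toLinearEquiv := (LinearEquiv.smulOfNeZero ℂ (CSpace d) c hc0).restrictScalars ℝ
      norm_map' := fun v => by
        change ‖c • v‖ = ‖v‖
        rw [norm_smul, hc1, one_mul] }
  have he : MeasurePreserving e (V d) (V d) := by
    refine ⟨e.continuous.measurable, ?_⟩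
    rw [V, Measure.map_smul, e.measurePreserving.map_eq]
  have hpre : e ⁻¹' A = A := by
    ext v
    refine ⟨fun hv => ?_, fun hv => hc c hc1 v hv⟩
    have h1 := hc c⁻¹ (by simp [hc1]) (c • v) hv
    rwa [inv_smul_smul₀ hc0] at h1
  have h3 := he.setLIntegral_comp_preimage hA hF
  rw [hpre] at h3
  exact h3

/-- Change of variables under real dilations. -/
theorem setLIntegral_real_smul {A B : Set (CSpace d)} (hB : MeasurableSet B) {γ : ℝ} (hγ : 0 < γ)
    (hAB : ∀ v ∈ A, γ • v ∈ B) {F : CSpace d → ℝ≥0∞} (hF : Measurable F) :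
    ENNReal.ofReal (γ ^ (2 * d)) * ∫⁻ v in A, F (γ • v) ∂(V d) ≤ ∫⁻ v in B, F v ∂(V d) := by
  have hmap := Measure.map_addHaar_smul (V d) hγ.ne'
  rw [finrank_real_CSpace, abs_of_pos (by positivity)] at hmap
  have hm : Measurable fun v : CSpace d => γ • v := measurable_const_smul γ
  have h1 : ∫⁻ v in A, F (γ • v) ∂(V d) ≤
      ENNReal.ofReal ((γ ^ (2 * d))⁻¹) * ∫⁻ v in B, F v ∂(V d) := by
    calc ∫⁻ v in A, F (γ • v) ∂(V d)
        ≤ ∫⁻ v in (fun v : CSpace d => γ • v) ⁻¹' B, F (γ • v) ∂(V d) := lintegral_mono_set hAB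
      _ = ∫⁻ v in B, F v ∂(Measure.map (fun v : CSpace d => γ • v) (V d)) :=
          (setLIntegral_map hB hF hm).symm
      _ = _ := by rw [hmap, Measure.restrict_smul, lintegral_smul_measure, smul_eq_mul]
  calc _ ≤ ENNReal.ofReal (γ ^ (2 * d)) *
        (ENNReal.ofReal ((γ ^ (2 * d))⁻¹) * ∫⁻ v in B, F v ∂(V d)) := mul_le_mul_right h1 _
    _ = _ := by
      rw [← mul_assoc, ← ENNReal.ofReal_mul (by positivity), mul_inv_cancel₀ (by positivity),
        ENNReal.ofReal_one, one_mul]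

theorem StrictlyCircled.smul_mem {D : Set (CSpace d)} {ζ : CSpace d} (h : StrictlyCircled D ζ)
    {μ : ℂ} (hμ : ‖μ‖ < 1) {v : CSpace d} (hv : ζ + v ∈ D) : ζ + μ • v ∈ D := by
  have h1 : μ • (ζ + v - ζ) ∈ (fun z => z - ζ) '' D :=
    (h μ hμ).2 (subset_closure ⟨ζ + v, hv, rfl⟩)
  obtain ⟨z, hz, h2⟩ := h1
  rw [add_sub_cancel_left] at h2
  rw [← h2]
  simpa using hz

theorem StrictlyCircled.centre_mem {D : Set (CSpace d)} {ζ : CSpace d} (h : StrictlyCircled D ζ)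
    (hD : D.Nonempty) : ζ ∈ D := by
  obtain ⟨z, hz⟩ := hD
  simpa using h.smul_mem (μ := 0) (by simp) (v := z - ζ) (by simpa using hz)

/-- Strict circledness speaks only of `|μ| < 1`. Pushing a point of an open set slightly outwards
first gives room to reach `|μ| = 1`. -/
theorem exists_one_lt_smul_mem {D : Set (CSpace d)} (hD : IsOpen D) {ζ v : CSpace d}
    (hv : ζ + v ∈ D) : ∃ s : ℝ, 1 < s ∧ ζ + s • v ∈ D := by
  have hO : IsOpen {s : ℝ | ζ + s • v ∈ D} := hD.preimage (by fun_prop)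
  have h1 : (1 : ℝ) ∈ {s : ℝ | ζ + s • v ∈ D} := by simpa using hv
  obtain ⟨ε, hε, hsub⟩ := Metric.isOpen_iff.1 hO 1 h1
  refine ⟨1 + ε / 2, by linarith, hsub ?_⟩
  rw [mem_ball, Real.dist_eq, add_sub_cancel_left, abs_of_pos (by positivity)]
  linarith

theorem StrictlyCircled.circle_smul_mem {D : Set (CSpace d)} {ζ : CSpace d}
    (h : StrictlyCircled D ζ) (hD : IsOpen D) {μ : ℂ} (hμ : ‖μ‖ = 1) {v : CSpace d}
    (hv : ζ + v ∈ D) : ζ + μ • v ∈ D := by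
  obtain ⟨s, hs, hsv⟩ := exists_one_lt_smul_mem hD hv
  have h1 := h.smul_mem (μ := μ * (s⁻¹ : ℝ)) (by
    rw [norm_mul, hμ, one_mul, Complex.norm_real, Real.norm_of_nonneg (by positivity)]
    exact inv_lt_one_of_one_lt₀ hs) hsv
  rwa [mul_smul, Complex.coe_smul, inv_smul_smul₀ (by positivity)] at h1

/-- A function on a dilate of a circled set that vanishes to order `k` at the centre is small in
quadratic mean on the set itself. -/
theorem StrictlyCircled.pow_mul_lintegral_le {D : Set (CSpace d)} {ζ : CSpace d}
    (h : StrictlyCircled D ζ) (hD : IsOpen D) {γ : ℝ} (hγ : 1 < γ) {Ω : Opens (CSpace d)}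
    (hΩ : dilate D ζ γ ⊆ Ω) (f : A2 Ω) {k : ℕ}
    (hk : ∀ v, ∀ j < k, iteratedDeriv j (fun t : ℂ => f (ζ + t • v)) 0 = 0) :
    ENNReal.ofReal (γ ^ (2 * (k + d))) * ∫⁻ z in D, ‖f z‖ₑ ^ 2 ∂(V d) ≤
      ∫⁻ z in Ω, ‖f z‖ₑ ^ 2 ∂(V d) := by
  have hγ0 : 0 < γ := zero_lt_one.trans hγ
  set A : Set (CSpace d) := (fun v => ζ + v) ⁻¹' D with hA
  have hAo : IsOpen A := hD.preimage (by fun_prop)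
  set B : Set (CSpace d) := (fun v => ζ + v) ⁻¹' Ω with hB
  have hBo : IsOpen B := Ω.isOpen.preimage (by fun_prop)
  have hAB : ∀ v ∈ A, γ • v ∈ B := fun v hv => by
    refine hΩ ⟨ζ + v, hv, ?_⟩
    simp only [add_sub_cancel_left, Complex.coe_smul]
    exact add_comm _ _
  set F : CSpace d → ℝ≥0∞ := fun v => ‖f (ζ + v)‖ₑ ^ 2 with hF
  have hFm : Measurable F := (f.measurable.comp (measurable_const_add ζ)).enorm.pow_const 2
  have htrans : ∀ C : Set (CSpace d), MeasurableSet C →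
      ∫⁻ v in (fun v => ζ + v) ⁻¹' C, F v ∂(V d) = ∫⁻ z in C, ‖f z‖ₑ ^ 2 ∂(V d) := fun C hC =>
    (measurePreserving_add_left (V d) ζ).setLIntegral_comp_preimage hC
      (f := fun z => ‖f z‖ₑ ^ 2) (f.measurable.enorm.pow_const 2)
  rw [← htrans D hD.measurableSet, ← htrans Ω Ω.isOpen.measurableSet]
  set ν : Measure ℝ := volume.restrict (Set.Ioc 0 (2 * Real.pi)) with hν
  have hν0 : ν Set.univ = ENNReal.ofReal (2 * Real.pi) := by simp [hν]
  have hpi : (0 : ℝ) < 2 * Real.pi := by positivity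
  have hν1 : ν Set.univ ≠ 0 := by rw [hν0]; simpa using hpi
  have hν2 : ν Set.univ ≠ ∞ := by rw [hν0]; exact ENNReal.ofReal_ne_top
  have hslice : ∀ v ∈ A, ENNReal.ofReal (γ ^ (2 * k)) * ∫⁻ θ, F (circleMap 0 1 θ • v) ∂ν ≤
      ∫⁻ θ, F (γ • circleMap 0 1 θ • v) ∂ν := by
    intro v hv
    -- The outward push makes the slice holomorphic on a disc of radius `γ * s`, strictly larger
    -- than `γ`, so the circle of radius `γ` lies inside.
    obtain ⟨s, hs, hsv⟩ := exists_one_lt_smul_mem hD (show ζ + v ∈ D from hv)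
    have hs0 : 0 < s := zero_lt_one.trans hs
    have hmaps : Set.MapsTo (fun t : ℂ => ζ + t • v) (ball 0 (γ * s)) Ω := fun t ht => by
      have h1 : ζ + (t * ((γ * s)⁻¹ : ℝ)) • (s • v) ∈ D := h.smul_mem (by
        rw [norm_mul, Complex.norm_real, Real.norm_of_nonneg (by positivity), ← div_eq_mul_inv,
          div_lt_one (by positivity)]
        simpa using ht) hsv
      have h2 := hAB _ h1
      have h3 : γ • (t * ((γ * s)⁻¹ : ℝ)) • (s • v) = t • v := by
        rw [← Complex.coe_smul, ← Complex.coe_smul s, smul_smul, smul_smul]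
        congr 1
        push_cast
        have : (γ : ℂ) ≠ 0 := by exact_mod_cast hγ0.ne'
        have : (s : ℂ) ≠ 0 := by exact_mod_cast hs0.ne'
        field_simp
      rw [h3] at h2
      exact h2
    have hdiff : DifferentiableOn ℂ (fun t : ℂ => f (ζ + t • v)) (ball 0 (γ * s)) :=
      f.differentiableOn.comp (by fun_prop) hmaps
    have hγs : γ < γ * s := lt_mul_of_one_lt_right hγ0 hs
    have h1 := pow_mul_integral_circle_le hγ.le hγs hdiff (hk v)
    have h2 := lintegral_circle_eq_ofReal zero_le_one (hγ.trans hγs) hdiff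
    have h3 := lintegral_circle_eq_ofReal hγ0.le hγs hdiff
    have h4 : ∀ θ, F (γ • circleMap 0 1 θ • v) = ‖f (ζ + circleMap 0 γ θ • v)‖ₑ ^ 2 := fun θ => by
      simp only [hF, ← Complex.coe_smul γ, smul_smul]
      congr 5
      simp [circleMap]
    rw [lintegral_congr h4]
    refine (mul_le_mul_right h2.le _).trans (le_trans ?_ h3.ge)
    rw [ ← ENNReal.ofReal_mul (by positivity)]
    exact ENNReal.ofReal_le_ofReal h1
  have hrotA : ∀ μ : ℂ, ‖μ‖ = 1 → ∀ v ∈ A, μ • v ∈ A := fun μ hμ v hv =>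
    h.circle_smul_mem hD hμ hv
  have hrot : ∀ G : CSpace d → ℝ≥0∞, Measurable G →
      (∫⁻ v in A, G v ∂(V d)) * ν Set.univ =
        ∫⁻ v in A, ∫⁻ θ, G (circleMap 0 1 θ • v) ∂ν ∂(V d) := by
    intro G hG
    rw [lintegral_lintegral_swap]
    · simp only [fun θ => setLIntegral_circle_smul hAo.measurableSet hrotA hG
        (c := circleMap 0 1 θ) (by simp)]
      rw [lintegral_const]
    · have : Continuous (fun p : CSpace d × ℝ => circleMap 0 1 p.2 • p.1) := by fun_prop
      exact (hG.comp this.measurable).aemeasurable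
  -- Averaging over rotations changes neither integral, so the slice inequality integrates over `A`
  -- and the common factor `2π` cancels.
  have h5 : ENNReal.ofReal (γ ^ (2 * k)) * ∫⁻ v in A, F v ∂(V d) ≤
      ∫⁻ v in A, F (γ • v) ∂(V d) := by
    refine (ENNReal.mul_le_mul_iff_left hν1 hν2).1 ?_
    rw [mul_assoc, hrot F hFm, hrot (fun v => F (γ • v)) (hFm.comp (measurable_const_smul γ)),
      ← lintegral_const_mul' _ _ ENNReal.ofReal_ne_top]
    exact setLIntegral_mono' hAo.measurableSet hslice
  calc ENNReal.ofReal (γ ^ (2 * (k + d))) * ∫⁻ v in A, F v ∂(V d)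
      = ENNReal.ofReal (γ ^ (2 * d)) *
          (ENNReal.ofReal (γ ^ (2 * k)) * ∫⁻ v in A, F v ∂(V d)) := by
        rw [← mul_assoc, ← ENNReal.ofReal_mul (by positivity), ← pow_add]
        congr 3
        ring
    _ ≤ ENNReal.ofReal (γ ^ (2 * d)) * ∫⁻ v in A, F (γ • v) ∂(V d) := mul_le_mul_right h5 _
    _ ≤ ∫⁻ v in B, F v ∂(V d) := setLIntegral_real_smul hBo.measurableSet hγ0 hAB hFm

end CircledDomains

/-! ### Decreasing enumerations with prescribed multiplicities. -/

section Rearrangement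

/-- A positive function with finite superlevel sets can be enumerated in decreasing order. -/
theorem exists_decreasing_enumeration {X : Type*} (f : X → ℝ) (hpos : ∀ x, 0 < f x)
    (hfin : ∀ ε > 0, {x | ε ≤ f x}.Finite) :
    ∃ e : X → ℕ, Function.Injective e ∧ (∀ x y, e x ≤ e y → f y ≤ f x) ∧
      ∀ y, ∀ n ≤ e y, ∃ x, e x = n := by
  classical
  let lo : LinearOrder X := linearOrderOfSTO (WellOrderingRel (α := X))
  -- Larger values come first; the auxiliary well-order only breaks ties.
  let g : X → ℝᵒᵈ ×ₗ X := fun x => toLex (OrderDual.toDual (f x), x)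
  have hg : Function.Injective g := fun x y h => congrArg (fun p => (ofLex p).2) h
  have hglt : ∀ x y, g x < g y → f y ≤ f x := fun x y h => by
    rcases Prod.Lex.toLex_lt_toLex.1 h with h | h
    · exact (OrderDual.toDual_lt_toDual.1 h).le
    · exact (OrderDual.toDual_inj.1 h.1).ge
  have hbelow : ∀ x, {y | g y < g x}.Finite := fun x =>
    (hfin (f x) (hpos x)).subset fun y hy => hglt _ _ hy
  -- The rank of `x` is its number of predecessors, finite because they lie in a superlevel set of
  -- `f`.
  let e : X → ℕ := fun x => {y | g y < g x}.ncard
  have hmono : ∀ x y, g x < g y → e x < e y := fun x y h =>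
    Set.ncard_lt_ncard ⟨fun z hz => lt_trans hz h, fun h' => lt_irrefl (g x) (h' (show g x < g y from h))⟩ (hbelow y)
  have hpred : ∀ n y, e y = n + 1 → ∃ x, e x = n := by
    intro n y hy
    have hne : {z | g z < g y}.Nonempty := by
      rw [← Set.ncard_pos (hbelow y)]
      change 0 < e y
      omega
    obtain ⟨x, hx, hmax⟩ := Set.exists_max_image _ g (hbelow y) hne
    refine ⟨x, ?_⟩
    have h1 : {z | g z < g y} = insert x {z | g z < g x} := by
      ext z
      refine ⟨fun hz => ?_, ?_⟩
      · rcases (hmax z hz).lt_or_eq with h | h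
        · exact Or.inr h
        · exact Or.inl (hg h)
      · rintro (rfl | hz)
        · exact hx
        · exact lt_trans (show g z < g x from hz) (show g x < g y from hx)
    have h2 : e y = e x + 1 := by
      change {z | g z < g y}.ncard = _
      rw [h1, Set.ncard_insert_of_notMem
        (show x ∉ {z | g z < g x} from fun h => lt_irrefl (g x) h) (hbelow x)]
    omega
  refine ⟨e, fun x y h => ?_, fun x y h => ?_, ?_⟩
  · rcases lt_trichotomy (g x) (g y) with h1 | h1 | h1
    · exact absurd h (hmono _ _ h1).ne
    · exact hg h1
    · exact absurd h (hmono _ _ h1).ne'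
  · rcases lt_trichotomy (g x) (g y) with h1 | h1 | h1
    · exact hglt _ _ h1
    · rw [hg h1]
    · exact absurd h (hmono _ _ h1).not_ge
  · intro y n hn
    obtain ⟨k, hk⟩ := Nat.exists_eq_add_of_le hn
    induction k generalizing y with
    | zero => exact ⟨y, hk⟩
    | succ k ih =>
      obtain ⟨x, hx⟩ := hpred (n + k) y hk
      exact ih x (by omega) hx

/-- Existence of a sequence with prescribed multiplicities and decreasing moduli. -/
theorem exists_antitone_norm_sequence (m : ℂ → ℕ)
    (hfin : ∀ ε > 0, {μ : ℂ | ε ≤ ‖μ‖ ∧ m μ ≠ 0}.Finite) :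
    ∃ lam : ℕ → ℂ, (Antitone fun n => ‖lam n‖) ∧ ∀ μ ≠ 0, {n | lam n = μ}.encard = m μ := by
  classical
  -- One point for each nonzero value and each copy demanded by its multiplicity.
  let X : Type := {p : ℂ × ℕ // p.1 ≠ 0 ∧ p.2 < m p.1}
  obtain ⟨e, he, hanti, hlow⟩ := exists_decreasing_enumeration (X := X) (fun x => ‖x.1.1‖)
    (fun x => norm_pos_iff.2 x.2.1) fun ε hε => by
      have h2 := ((hfin ε hε).toFinset.biUnion fun μ =>
          (Finset.range (m μ)).image fun i => (μ, i)).finite_toSet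
      refine (h2.preimage (f := Subtype.val) Subtype.val_injective.injOn).subset fun x hx => ?_
      simp only [Set.mem_preimage, Finset.mem_coe, Finset.mem_biUnion, Set.Finite.mem_toFinset,
        Finset.mem_image, Finset.mem_range, Set.mem_ofPred_eq]
      exact ⟨x.1.1, ⟨hx, fun h => by have := x.2.2; omega⟩, x.1.2, x.2.2, rfl⟩
  let lam : ℕ → ℂ := fun n => if h : ∃ x, e x = n then h.choose.1.1 else 0
  have hlam : ∀ x, lam (e x) = x.1.1 := fun x => by
    have h : ∃ y, e y = e x := ⟨x, rfl⟩
    simp only [lam, dif_pos h, he h.choose_spec]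
  have hlam0 : ∀ n, (¬ ∃ x, e x = n) → lam n = 0 := fun n h => by simp only [lam, dif_neg h]
  refine ⟨lam, fun n n' hn => ?_, fun μ hμ => ?_⟩
  · by_cases h : ∃ x, e x = n'
    · obtain ⟨y, rfl⟩ := h
      obtain ⟨x, rfl⟩ := hlow y n hn
      simpa only [hlam] using hanti x y hn
    · simp [hlam0 n' h]
  · have h1 : {n | lam n = μ} = (fun i : Fin (m μ) => e ⟨(μ, i), hμ, i.2⟩) '' Set.univ := by
      ext n
      simp only [Set.mem_ofPred_eq, Set.image_univ, Set.mem_range]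
      constructor
      · intro h
        by_cases h' : ∃ x, e x = n
        · obtain ⟨x, rfl⟩ := h'
          rw [hlam] at h
          subst h
          exact ⟨⟨x.1.2, x.2.2⟩, rfl⟩
        · exact absurd (h.symm.trans (hlam0 n h')) hμ
      · rintro ⟨i, rfl⟩
        rw [hlam]
    rw [h1, Function.Injective.encard_image]
    · simp
    · intro i j h
      exact Fin.ext (congrArg (fun x : X => x.1.2) (he h))

end Rearrangement

/-! ### Singular values and determinants in finite dimension. -/

section FiniteDimensional

variable {E : Type*} [NormedAddCommGroup E] [InnerProductSpace ℂ E] [FiniteDimensional ℂ E]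

theorem re_inner_eq_sum_eigenvalues {T : E →ₗ[ℂ] E} (hT : T.IsSymmetric) {n : ℕ}
    (hn : Module.finrank ℂ E = n) (x : E) :
    (inner ℂ (T x) x).re =
      ∑ i, hT.eigenvalues hn i * ‖inner ℂ (hT.eigenvectorBasis hn i) x‖ ^ 2 := by
  set b := hT.eigenvectorBasis hn
  have h1 := b.sum_inner_mul_inner (T x) x
  rw [← h1, Complex.re_sum]
  refine Finset.sum_congr rfl fun i _ => ?_
  rw [hT x (b i), hT.apply_eigenvectorBasis hn i, inner_smul_right, mul_assoc,
    ← inner_conj_symm x (b i), mul_comm ((starRingEnd ℂ) _), Complex.mul_conj,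
    Complex.normSq_eq_norm_sq]
  exact (congrArg Complex.re (Complex.ofReal_mul _ _).symm).trans (Complex.ofReal_re _)

/-- Courant–Fischer: the first `i + 1` singular vectors span a space on which `‖B x‖` is at least
the singular value times `‖x‖`, and at most `i` linear conditions cannot exclude all its nonzero
vectors. -/
theorem singularValues_le_of_kernel {B : E →ₗ[ℂ] E} {i m : ℕ} (hi : i < Module.finrank ℂ E)
    (hm : m ≤ i) (Λ : E →ₗ[ℂ] (Fin m → ℂ)) {σ : ℝ} (h : ∀ x, Λ x = 0 → ‖B x‖ ≤ σ * ‖x‖) :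
    B.singularValues i ≤ σ := by
  set T := LinearMap.adjoint B ∘ₗ B
  have hT : T.IsSymmetric := (LinearMap.isPositive_adjoint_comp_self B).isSymmetric
  set b := hT.eigenvectorBasis rfl
  -- Orthogonality to the later singular vectors together with `Λ`: in all `finrank - (i + 1) + m`
  -- conditions, fewer than the dimension.
  let Φ : E →ₗ[ℂ] ({j : Fin (Module.finrank ℂ E) // i < j} → ℂ) × (Fin m → ℂ) :=
    (LinearMap.pi fun j => (innerₛₗ ℂ (b j.1))).prod Λ
  have hker : LinearMap.ker Φ ≠ ⊥ := by
    refine LinearMap.ker_ne_bot_of_finrank_lt ?_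
    have hcard : Fintype.card {j : Fin (Module.finrank ℂ E) // i < j} =
        Module.finrank ℂ E - (i + 1) := by
      rw [Fintype.card_subtype]
      have : (Finset.univ.filter fun j : Fin (Module.finrank ℂ E) => i < j) =
          Finset.Ioi ⟨i, hi⟩ := by
        ext j; simp [Fin.lt_def]
      rw [this, Fin.card_Ioi]
      simp only []
      omega
    rw [Module.finrank_prod, Module.finrank_fintype_fun_eq_card,
      Module.finrank_fintype_fun_eq_card, hcard, Fintype.card_fin]
    omega
  obtain ⟨x, hx, hx0⟩ := Submodule.exists_mem_ne_zero_of_ne_bot hker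
  have hx' : Φ x = 0 := hx
  have hΛ : Λ x = 0 := congrArg Prod.snd hx'
  have hb : ∀ j : Fin (Module.finrank ℂ E), i < j → inner ℂ (b j) x = 0 := fun j hj =>
    congrFun (congrArg Prod.fst hx') ⟨j, hj⟩
  have hxpos : 0 < ‖x‖ := norm_pos_iff.2 hx0
  have h1 := h x hΛ
  have hσ : 0 ≤ σ := by
    by_contra hσ
    nlinarith [norm_nonneg (B x)]
  have h2 : (inner ℂ (T x) x).re = ‖B x‖ ^ 2 := by
    change (inner ℂ (LinearMap.adjoint B (B x)) x).re = _
    rw [LinearMap.adjoint_inner_left, ← RCLike.re_eq_complex_re, inner_self_eq_norm_sq]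
  rw [re_inner_eq_sum_eigenvalues hT rfl] at h2
  have h3 : B.singularValues i ^ 2 = hT.eigenvalues rfl ⟨i, hi⟩ := B.sq_singularValues_of_lt rfl hi
  have h4 : hT.eigenvalues rfl ⟨i, hi⟩ * ‖x‖ ^ 2 ≤ ‖B x‖ ^ 2 := by
    rw [← h2, ← b.sum_sq_norm_inner_right x, Finset.mul_sum]
    refine Finset.sum_le_sum fun j _ => ?_
    rcases lt_or_ge i (j : ℕ) with hj | hj
    · simp [b, hb j hj]
    · exact mul_le_mul_of_nonneg_right (hT.eigenvalues_antitone rfl (show j ≤ ⟨i, hi⟩ from hj))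
        (by positivity)
  rw [← h3] at h4
  refine le_of_sq_le_sq ?_ hσ
  have h5 : ‖B x‖ ^ 2 ≤ σ ^ 2 * ‖x‖ ^ 2 := by
    rw [← mul_pow]; exact pow_le_pow_left₀ (norm_nonneg _) h1 2
  exact le_of_mul_le_mul_right (h4.trans h5) (by positivity)

/-- The determinant is the product of the roots of the characteristic polynomial, with multiplicity.
-/
theorem pow_le_norm_det {B : E →ₗ[ℂ] E} {ε : ℝ} (hε : 0 ≤ ε)
    (h : ∀ μ, Module.End.HasEigenvalue B μ → ε ≤ ‖μ‖) :
    ε ^ Module.finrank ℂ E ≤ ‖LinearMap.det B‖ := by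
  have hs : (LinearMap.charpoly B).Splits := IsAlgClosed.splits _
  rw [Module.End.det_eq_prod_roots_charpoly_of_splits hs, ← B.charpoly_natDegree,
    hs.natDegree_eq_card_roots]
  have hr : ∀ μ ∈ (LinearMap.charpoly B).roots, ε ≤ ‖μ‖ := fun μ hμ =>
    h μ ((Module.End.hasEigenvalue_iff_isRoot_charpoly B μ).2 (Polynomial.isRoot_of_mem_roots hμ))
  generalize (LinearMap.charpoly B).roots = s at hr
  induction s using Multiset.induction_on with
  | empty => simp
  | cons a s ih =>
    rw [Multiset.card_cons, Multiset.prod_cons, pow_succ', norm_mul]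
    exact mul_le_mul (hr a (Multiset.mem_cons_self a s))
      (ih fun μ hμ => hr μ (Multiset.mem_cons_of_mem hμ)) (by positivity) (norm_nonneg _)

end FiniteDimensional

/-! ### Sums of generalised eigenspaces. -/

section GeneralizedEigenspaces

open Module.End in
/-- The sum of the generalised eigenspaces with eigenvalue in `S`. -/
def genEigenspaceSum {H : Type*} [AddCommGroup H] [Module ℂ H] (T : Module.End ℂ H) (S : Set ℂ) :
    Submodule ℂ H :=
  ⨆ μ ∈ S, maxGenEigenspace T μ

variable {H : Type*} [AddCommGroup H] [Module ℂ H] {T : Module.End ℂ H} {S : Set ℂ}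

theorem maxGenEigenspace_le_genEigenspaceSum {μ : ℂ} (hμ : μ ∈ S) :
    Module.End.maxGenEigenspace T μ ≤ genEigenspaceSum T S :=
  le_iSup₂_of_le μ hμ le_rfl

theorem genEigenspaceSum_mono {S' : Set ℂ} (h : S ⊆ S') :
    genEigenspaceSum T S ≤ genEigenspaceSum T S' :=
  iSup₂_le fun _ hμ => maxGenEigenspace_le_genEigenspaceSum (h hμ)

theorem apply_mem_maxGenEigenspace {μ : ℂ} {x : H} (hx : x ∈ Module.End.maxGenEigenspace T μ) :
    T x ∈ Module.End.maxGenEigenspace T μ :=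
  Module.End.mapsTo_maxGenEigenspace_of_comm (Commute.refl T) μ hx

theorem apply_mem_genEigenspaceSum : ∀ x ∈ genEigenspaceSum T S, T x ∈ genEigenspaceSum T S := by
  intro x hx
  have h : genEigenspaceSum T S ≤ (genEigenspaceSum T S).comap T :=
    iSup₂_le fun μ hμ x hx =>
      maxGenEigenspace_le_genEigenspaceSum hμ (apply_mem_maxGenEigenspace hx)
  exact h hx

/-- Eigenvectors with eigenvalue outside `S` do not lie in the sum over `S`. -/
theorem eq_zero_of_mem_genEigenspaceSum {μ : ℂ} (hμ : μ ∉ S) {x : H} (hx : T x = μ • x)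
    (hxS : x ∈ genEigenspaceSum T S) : x = 0 := by
  have h1 := T.independent_maxGenEigenspace.disjoint_biSup hμ
  refine Submodule.disjoint_def.1 h1 x ?_ hxS
  rw [Module.End.mem_maxGenEigenspace]
  exact ⟨1, by simp [hx]⟩

/-- Determinant estimates need finite-dimensional invariant subspaces before the whole sum is known
to be finite-dimensional. For `x` killed by `(T - μ)^k`, the vectors `(T - μ)^j x` span one; finite
sums of these handle the general element. -/
theorem exists_finiteDimensional_invariant {x : H} (hx : x ∈ genEigenspaceSum T S) :
    ∃ W : Submodule ℂ H, FiniteDimensional ℂ W ∧ (∀ y ∈ W, T y ∈ W) ∧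
      W ≤ genEigenspaceSum T S ∧ x ∈ W := by
  refine Submodule.iSup_induction' (p := fun μ => ⨆ _ : μ ∈ S, Module.End.maxGenEigenspace T μ)
    (motive := fun x _ => ∃ W : Submodule ℂ H, FiniteDimensional ℂ W ∧ (∀ y ∈ W, T y ∈ W) ∧
      W ≤ genEigenspaceSum T S ∧ x ∈ W) ?_ ?_ ?_ hx
  · intro μ x hx
    by_cases hμ : μ ∈ S
    · rw [iSup_pos hμ] at hx
      obtain ⟨k, hk⟩ := (Module.End.mem_maxGenEigenspace T μ x).1 hx
      set D : Module.End ℂ H := T - μ • 1 with hD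
      have hDmem : ∀ j, (D ^ j) x ∈ Module.End.maxGenEigenspace T μ := fun j => by
        induction j with
        | zero => simpa using hx
        | succ j ih =>
          rw [pow_succ', Module.End.mul_apply, hD, LinearMap.sub_apply]
          exact Submodule.sub_mem _ (apply_mem_maxGenEigenspace ih) (Submodule.smul_mem _ μ ih)
      refine ⟨Submodule.span ℂ ((fun j => (D ^ j) x) '' (Finset.range (k + 1) : Set ℕ)),
        FiniteDimensional.span_of_finite ℂ ((Finset.finite_toSet _).image _), ?_, ?_, ?_⟩
      · intro y hy
        have h0 : ∀ j ∈ Finset.range (k + 1), (D ^ j) x ∈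
            Submodule.span ℂ ((fun j => (D ^ j) x) '' (Finset.range (k + 1) : Set ℕ)) :=
          fun j hj => Submodule.subset_span ⟨j, hj, rfl⟩
        induction hy using Submodule.span_induction with
        | mem y hy =>
          obtain ⟨j, hj, rfl⟩ := hy
          have h1 : T ((D ^ j) x) = (D ^ (j + 1)) x + μ • (D ^ j) x := by
            rw [pow_succ', Module.End.mul_apply, hD]; simp
          simp only [h1]
          refine Submodule.add_mem _ ?_ (Submodule.smul_mem _ _ (h0 j hj))
          rcases (Finset.mem_range_succ_iff.1 hj).lt_or_eq with h2 | h2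
          · exact h0 (j + 1) (Finset.mem_range.2 (by omega))
          · rw [h2, pow_succ', Module.End.mul_apply, hk, map_zero]
            exact Submodule.zero_mem _
        | zero => simp
        | add a b _ _ ha hb => rw [map_add]; exact Submodule.add_mem _ ha hb
        | smul c a _ ha => rw [map_smul]; exact Submodule.smul_mem _ _ ha
      · rw [Submodule.span_le]
        rintro _ ⟨j, _, rfl⟩
        exact maxGenEigenspace_le_genEigenspaceSum hμ (hDmem j)
      · exact Submodule.subset_span ⟨0, by simp, by simp⟩
    · rw [iSup_neg hμ, Submodule.mem_bot] at hx
      exact ⟨⊥, inferInstance, by simp, bot_le, by simp [hx]⟩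
  · exact ⟨⊥, inferInstance, by simp, bot_le, by simp⟩
  · rintro x y _ _ ⟨W₁, hf₁, hi₁, hl₁, hx₁⟩ ⟨W₂, hf₂, hi₂, hl₂, hx₂⟩
    refine ⟨W₁ ⊔ W₂, inferInstance, fun z hz => ?_, sup_le hl₁ hl₂,
      Submodule.add_mem _ (Submodule.mem_sup_left hx₁) (Submodule.mem_sup_right hx₂)⟩
    obtain ⟨a, ha, b, hb, rfl⟩ := Submodule.mem_sup.1 hz
    rw [map_add]
    exact Submodule.add_mem _ (Submodule.mem_sup_left (hi₁ a ha))
      (Submodule.mem_sup_right (hi₂ b hb))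

theorem exists_finiteDimensional_invariant_finset (s : Finset H)
    (hs : ∀ x ∈ s, x ∈ genEigenspaceSum T S) :
    ∃ W : Submodule ℂ H, FiniteDimensional ℂ W ∧ (∀ y ∈ W, T y ∈ W) ∧
      W ≤ genEigenspaceSum T S ∧ ∀ x ∈ s, x ∈ W := by
  classical
  induction s using Finset.induction_on with
  | empty => exact ⟨⊥, inferInstance, by simp, bot_le, by simp⟩
  | insert a s _ ih =>
    obtain ⟨W₁, hf₁, hi₁, hl₁, hx₁⟩ := ih fun x hx => hs x (Finset.mem_insert_of_mem hx)
    obtain ⟨W₂, hf₂, hi₂, hl₂, hx₂⟩ :=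
      exists_finiteDimensional_invariant (hs a (Finset.mem_insert_self a s))
    refine ⟨W₁ ⊔ W₂, inferInstance, fun z hz => ?_, sup_le hl₁ hl₂, fun x hx => ?_⟩
    · obtain ⟨a, ha, b, hb, rfl⟩ := Submodule.mem_sup.1 hz
      rw [map_add]
      exact Submodule.add_mem _ (Submodule.mem_sup_left (hi₁ a ha))
        (Submodule.mem_sup_right (hi₂ b hb))
    · rcases Finset.mem_insert.1 hx with rfl | hx
      · exact Submodule.mem_sup_right hx₂
      · exact Submodule.mem_sup_left (hx₁ x hx)

/-- Any finite independent family lies in a single finite-dimensional invariant subspace, so a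
uniform bound on the dimensions of these bounds the rank. -/
theorem finiteDimensional_genEigenspaceSum (k : ℕ)
    (h : ∀ W : Submodule ℂ H, FiniteDimensional ℂ W → (∀ y ∈ W, T y ∈ W) →
      W ≤ genEigenspaceSum T S → Module.finrank ℂ W ≤ k) :
    FiniteDimensional ℂ (genEigenspaceSum T S) := by
  classical
  have hrank : Module.rank ℂ (genEigenspaceSum T S) ≤ k := by
    refine rank_le fun s hs => ?_
    obtain ⟨W, hf, hi, hl, hx⟩ := exists_finiteDimensional_invariant_finset (T := T) (S := S)
      (s.image Subtype.val) (by simp +contextual)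
    refine le_trans ?_ (h W hf hi hl)
    have hW : ∀ x : s, ((x : genEigenspaceSum T S) : H) ∈ W := fun x =>
      hx _ (Finset.mem_image_of_mem _ x.2)
    have hli : LinearIndependent ℂ fun x : s => (⟨_, hW x⟩ : W) := by
      refine LinearIndependent.of_comp W.subtype ?_
      exact hs.map' (genEigenspaceSum T S).subtype (Submodule.ker_subtype _)
    have := hli.fintype_card_le_finrank
    simpa using this
  exact Module.rank_lt_aleph0_iff.1 (hrank.trans_lt (Cardinal.natCast_lt_aleph0))

theorem genEigenspaceSum_insert (a : ℂ) (S : Set ℂ) : genEigenspaceSum T (insert a S) =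
    Module.End.maxGenEigenspace T a ⊔ genEigenspaceSum T S :=
  iSup_insert

theorem disjoint_genEigenspaceSum {a : ℂ} (ha : a ∉ S) :
    Disjoint (Module.End.maxGenEigenspace T a) (genEigenspaceSum T S) :=
  T.independent_maxGenEigenspace.disjoint_biSup ha

theorem finrank_genEigenspaceSum_insert {a : ℂ} (ha : a ∉ S)
    [FiniteDimensional ℂ (Module.End.maxGenEigenspace T a)]
    [FiniteDimensional ℂ (genEigenspaceSum T S)] :
    Module.finrank ℂ (genEigenspaceSum T (insert a S)) =
      Module.finrank ℂ (Module.End.maxGenEigenspace T a) +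
        Module.finrank ℂ (genEigenspaceSum T S) := by
  rw [genEigenspaceSum_insert, ← Submodule.finrank_sup_add_finrank_inf_eq,
    (disjoint_genEigenspaceSum ha).eq_bot, finrank_bot, add_zero]

end GeneralizedEigenspaces

/-! ### Existence of eigenvalue sequences and dimension counts. -/

section EigenvalueSequences

variable {H : Type*} [NormedAddCommGroup H] [InnerProductSpace ℂ H]

/-- The generalised eigenspaces of `T` with eigenvalues bounded away from `0` span a
finite-dimensional space. -/
def RieszOperator (T : H →L[ℂ] H) : Prop :=
  ∀ ε > 0, FiniteDimensional ℂ (genEigenspaceSum (T : Module.End ℂ H) {μ | ε ≤ ‖μ‖})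

variable {T : H →L[ℂ] H}

theorem RieszOperator.finiteDimensional_maxGenEigenspace (hT : RieszOperator T) {μ : ℂ}
    (hμ : μ ≠ 0) : FiniteDimensional ℂ (Module.End.maxGenEigenspace (T : Module.End ℂ H) μ) := by
  have := hT ‖μ‖ (norm_pos_iff.2 hμ)
  exact Submodule.finiteDimensional_of_le
    (maxGenEigenspace_le_genEigenspaceSum (S := {ν | ‖μ‖ ≤ ‖ν‖}) (le_refl ‖μ‖))

theorem RieszOperator.finset_genEigenspaceSum (hT : RieszOperator T) (F : Finset ℂ)
    (hF : (0 : ℂ) ∉ F) :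
    FiniteDimensional ℂ (genEigenspaceSum (T : Module.End ℂ H) F) ∧
      Module.finrank ℂ (genEigenspaceSum (T : Module.End ℂ H) F) = ∑ μ ∈ F,
        Module.finrank ℂ (Module.End.maxGenEigenspace (T : Module.End ℂ H) μ) := by
  classical
  induction F using Finset.induction_on with
  | empty =>
    have h : genEigenspaceSum (T : Module.End ℂ H) ((∅ : Finset ℂ) : Set ℂ) = ⊥ := by
      simp [genEigenspaceSum]
    rw [h]
    exact ⟨inferInstance, by simp⟩
  | insert a F ha ih =>
    obtain ⟨h1, h2⟩ := ih fun h => hF (Finset.mem_insert_of_mem h)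
    have h3 := hT.finiteDimensional_maxGenEigenspace (μ := a) fun h =>
      hF (h ▸ Finset.mem_insert_self a F)
    rw [Finset.coe_insert, Finset.sum_insert ha, ← h2]
    refine ⟨?_, finrank_genEigenspaceSum_insert (by simpa using ha)⟩
    rw [genEigenspaceSum_insert]
    infer_instance

/-- Generalised eigenspaces are independent, so only finitely many nontrivial ones with `|μ| ≥ ε`
fit into a finite-dimensional sum; this is the finiteness that the decreasing enumeration requires.
-/
theorem RieszOperator.exists_isEigenvalueSequence (hT : RieszOperator T) :
    ∃ lam, IsEigenvalueSequence T lam := by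
  obtain ⟨lam, h1, h2⟩ := exists_antitone_norm_sequence
    (fun μ => Module.finrank ℂ (Module.End.maxGenEigenspace (T : Module.End ℂ H) μ)) fun ε hε => by
      by_contra hinf
      have := hT ε hε
      obtain ⟨F, hF, hcard⟩ := Set.Infinite.exists_subset_card_eq hinf
        (Module.finrank ℂ (genEigenspaceSum (T : Module.End ℂ H) {μ | ε ≤ ‖μ‖}) + 1)
      have hF0 : (0 : ℂ) ∉ F := fun h => by
        have := (hF h).1
        rw [norm_zero] at this
        linarith
      obtain ⟨_, h4⟩ := hT.finset_genEigenspaceSum F hF0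
      have h5 : F.card ≤ ∑ μ ∈ F,
          Module.finrank ℂ (Module.End.maxGenEigenspace (T : Module.End ℂ H) μ) := by
        rw [Finset.card_eq_sum_ones]
        exact Finset.sum_le_sum fun μ hμ => Nat.one_le_iff_ne_zero.2 (hF hμ).2
      have h6 := Submodule.finrank_mono
        (genEigenspaceSum_mono (T := (T : Module.End ℂ H)) (S := F)
          (S' := {μ | ε ≤ ‖μ‖}) fun μ hμ => (hF hμ).1)
      omega
  refine ⟨lam, h1, fun μ hμ => ?_⟩
  have := hT.finiteDimensional_maxGenEigenspace hμ
  rw [h2 μ hμ, ← Module.finrank_eq_rank, Cardinal.toENat_nat]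

variable {lam : ℕ → ℂ}

theorem IsEigenvalueSequence.encard_finset (hlam : IsEigenvalueSequence T lam)
    (hT : RieszOperator T) (F : Finset ℂ) (hF : (0 : ℂ) ∉ F) : {n | lam n ∈ F}.encard =
      Module.finrank ℂ (genEigenspaceSum (T : Module.End ℂ H) F) := by
  classical
  rw [(hT.finset_genEigenspaceSum F hF).2]
  induction F using Finset.induction_on with
  | empty => simp
  | insert a F ha ih =>
    have ha0 : a ≠ 0 := fun h => hF (h ▸ Finset.mem_insert_self a F)
    have h1 : {n | lam n ∈ insert a F} = {n | lam n = a} ∪ {n | lam n ∈ F} := by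
      ext n; simp
    have hdis : Disjoint {n | lam n = a} {n | lam n ∈ F} :=
      Set.disjoint_left.2 fun n (hn : lam n = a) (hn' : lam n ∈ F) => ha (hn ▸ hn')
    have := hT.finiteDimensional_maxGenEigenspace ha0
    rw [h1, Set.encard_union_eq hdis, ih fun h => hF (Finset.mem_insert_of_mem h),
      hlam.multiplicity a ha0, Finset.sum_insert ha, ← Module.finrank_eq_rank, Cardinal.toENat_nat]
    push_cast
    rfl

theorem IsEigenvalueSequence.maxGenEigenspace_eq_bot (hlam : IsEigenvalueSequence T lam)
    (hT : RieszOperator T) {μ : ℂ} (hμ : μ ≠ 0) (h : ∀ n, lam n ≠ μ) :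
    Module.End.maxGenEigenspace (T : Module.End ℂ H) μ = ⊥ := by
  have h1 := hlam.multiplicity μ hμ
  have := hT.finiteDimensional_maxGenEigenspace hμ
  rw [Set.eq_empty_of_forall_notMem (s := {n | lam n = μ}) h, Set.encard_empty,
    ← Module.finrank_eq_rank, Cardinal.toENat_nat] at h1
  exact Submodule.finrank_eq_zero.1 (by exact_mod_cast h1.symm)

/-- Values not attained by `lam` have trivial generalised eigenspace, so a possibly infinite `S`
reduces to the finite set of values that `lam` takes in it. -/
theorem IsEigenvalueSequence.finrank_eq_ncard (hlam : IsEigenvalueSequence T lam)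
    (hT : RieszOperator T) {S : Set ℂ} (hS : (0 : ℂ) ∉ S) (hfin : {n | lam n ∈ S}.Finite) :
    FiniteDimensional ℂ (genEigenspaceSum (T : Module.End ℂ H) S) ∧
      Module.finrank ℂ (genEigenspaceSum (T : Module.End ℂ H) S) = {n | lam n ∈ S}.ncard := by
  classical
  set F : Finset ℂ := hfin.toFinset.image lam
  have hFS : ∀ μ ∈ F, μ ∈ S := by
    intro μ hμ
    obtain ⟨n, hn, rfl⟩ := Finset.mem_image.1 hμ
    exact hfin.mem_toFinset.1 hn
  have hF : ∀ n, lam n ∈ F ↔ lam n ∈ S := fun n =>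
    ⟨hFS _, fun h => Finset.mem_image_of_mem _ (hfin.mem_toFinset.2 h)⟩
  have hF0 : (0 : ℂ) ∉ F := fun h => hS (hFS _ h)
  have heq : genEigenspaceSum (T : Module.End ℂ H) S = genEigenspaceSum (T : Module.End ℂ H) F := by
    refine le_antisymm (iSup₂_le fun μ hμ => ?_) (genEigenspaceSum_mono hFS)
    by_cases h : ∃ n, lam n = μ
    · obtain ⟨n, rfl⟩ := h
      exact maxGenEigenspace_le_genEigenspaceSum (Finset.mem_coe.2 ((hF n).2 hμ))
    · push Not at h
      rw [hlam.maxGenEigenspace_eq_bot hT (fun h0 => hS (h0 ▸ hμ)) h]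
      exact bot_le
  rw [heq]
  refine ⟨(hT.finset_genEigenspaceSum F hF0).1, ?_⟩
  have h1 := hlam.encard_finset hT F hF0
  simp only [hF] at h1
  rw [Set.ncard_def, h1, ENat.toNat_natCast]

theorem IsEigenvalueSequence.finite_of_le_norm (hlam : IsEigenvalueSequence T lam)
    (hT : RieszOperator T) {ε : ℝ} (hε : 0 < ε) : {n | lam n ∈ {μ : ℂ | ε ≤ ‖μ‖}}.Finite := by
  classical
  by_contra hinf
  have := hT ε hε
  obtain ⟨J, hJ, hcard⟩ := Set.Infinite.exists_subset_card_eq hinf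
    (Module.finrank ℂ (genEigenspaceSum (T : Module.End ℂ H) {μ | ε ≤ ‖μ‖}) + 1)
  have hFS : ((J.image lam : Finset ℂ) : Set ℂ) ⊆ {μ | ε ≤ ‖μ‖} := by
    intro μ hμ
    obtain ⟨n, hn, rfl⟩ := Finset.mem_image.1 (Finset.mem_coe.1 hμ)
    exact hJ hn
  have hF0 : (0 : ℂ) ∉ J.image lam := fun h => by
    have h1 : ε ≤ ‖(0 : ℂ)‖ := hFS (Finset.mem_coe.2 h)
    rw [norm_zero] at h1
    linarith
  have h1 := hlam.encard_finset hT _ hF0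
  have h2 : (J : Set ℕ).encard ≤ {n | lam n ∈ J.image lam}.encard :=
    Set.encard_le_encard fun n hn => Finset.mem_image_of_mem _ hn
  have h3 := Submodule.finrank_mono (genEigenspaceSum_mono (T := (T : Module.End ℂ H)) hFS)
  rw [h1, Set.encard_coe_eq_coe_finsetCard, hcard] at h2
  have h4 := Nat.cast_le.1 h2
  omega

/-- The weak inequality captures the entries `0, …, n`, and perhaps later ones of equal modulus;
this is the count behind Weyl's inequality and the upper bound for singular values. -/
theorem IsEigenvalueSequence.succ_le_finrank (hlam : IsEigenvalueSequence T lam)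
    (hT : RieszOperator T) {n : ℕ} (hn : lam n ≠ 0) :
    n + 1 ≤ Module.finrank ℂ (genEigenspaceSum (T : Module.End ℂ H) {μ | ‖lam n‖ ≤ ‖μ‖}) := by
  have hpos : 0 < ‖lam n‖ := norm_pos_iff.2 hn
  have hfin := hlam.finite_of_le_norm hT hpos
  rw [(hlam.finrank_eq_ncard hT (by simpa using hn) hfin).2]
  calc n + 1 = (Finset.range (n + 1) : Set ℕ).ncard := by
        rw [Set.ncard_coe_finset, Finset.card_range]
    _ ≤ _ := Set.ncard_le_ncard (fun j hj => hlam.antitone (Finset.mem_range_succ_iff.1 hj)) hfin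

/-- With the strict inequality only entries of index below `n` can occur, which provides the `n`
conditions realising the singular value of index `n`. -/
theorem IsEigenvalueSequence.finrank_le (hlam : IsEigenvalueSequence T lam)
    (hT : RieszOperator T) (n : ℕ) :
    FiniteDimensional ℂ (genEigenspaceSum (T : Module.End ℂ H) {μ | ‖lam n‖ < ‖μ‖}) ∧
      Module.finrank ℂ (genEigenspaceSum (T : Module.End ℂ H) {μ | ‖lam n‖ < ‖μ‖}) ≤ n := by
  have hsub : {j | lam j ∈ {μ : ℂ | ‖lam n‖ < ‖μ‖}} ⊆ (Finset.range n : Set ℕ) := by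
    intro j hj
    rw [Finset.mem_coe, Finset.mem_range]
    by_contra hjn
    exact absurd (hlam.antitone (not_lt.1 hjn)) (not_le.2 hj)
  have hfin := (Finset.finite_toSet (Finset.range n)).subset hsub
  obtain ⟨h1, h2⟩ := hlam.finrank_eq_ncard hT (S := {μ : ℂ | ‖lam n‖ < ‖μ‖}) (by simp) hfin
  refine ⟨h1, h2.trans_le ?_⟩
  calc _ ≤ (Finset.range n : Set ℕ).ncard := Set.ncard_le_ncard hsub (Finset.finite_toSet _)
    _ = n := by rw [Set.ncard_coe_finset, Finset.card_range]

end EigenvalueSequences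

/-! ### Smallness on finite codimension, compactness, minimax and Weyl's inequality. -/

section SingularValues

variable {H : Type*} [NormedAddCommGroup H] [InnerProductSpace ℂ H]
  {K : Type*} [NormedAddCommGroup K] [InnerProductSpace ℂ K]

/-- The operator `A` is bounded by `σ` on a subspace of codimension at most `n`. -/
def KernelBound (A : H →L[ℂ] K) (n : ℕ) (σ : ℝ) : Prop :=
  ∃ m ≤ n, ∃ Λ : H →ₗ[ℂ] (Fin m → ℂ), ∀ f, Λ f = 0 → ‖A f‖ ≤ σ * ‖f‖

theorem KernelBound.mono {A : H →L[ℂ] K} {n n' : ℕ} {σ σ' : ℝ} (h : KernelBound A n σ)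
    (hn : n ≤ n') (hσ : σ ≤ σ') : KernelBound A n' σ' := by
  obtain ⟨m, hm, Λ, hΛ⟩ := h
  exact ⟨m, hm.trans hn, Λ, fun f hf =>
    (hΛ f hf).trans (mul_le_mul_of_nonneg_right hσ (norm_nonneg f))⟩

theorem kernelBound_opNorm (A : H →L[ℂ] K) (n : ℕ) : KernelBound A n ‖A‖ :=
  ⟨0, n.zero_le, 0, fun f _ => A.le_opNorm f⟩

/-- The operator `A` is arbitrarily small on subspaces of finite codimension. -/
def SmallOnFiniteCodim (A : H →L[ℂ] K) : Prop := ∀ ε > 0, ∃ n, KernelBound A n ε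

theorem SmallOnFiniteCodim.comp_left {L : Type*} [NormedAddCommGroup L] [InnerProductSpace ℂ L]
    {A : H →L[ℂ] K} (hA : SmallOnFiniteCodim A) (B : K →L[ℂ] L) :
    SmallOnFiniteCodim (B.comp A) := by
  intro ε hε
  obtain ⟨n, m, hm, Λ, hΛ⟩ := hA (ε / (‖B‖ + 1)) (by positivity)
  refine ⟨n, m, hm, Λ, fun f hf => ?_⟩
  calc ‖B (A f)‖ ≤ ‖B‖ * (ε / (‖B‖ + 1) * ‖f‖) :=
        (B.le_opNorm _).trans (mul_le_mul_of_nonneg_left (hΛ f hf) (norm_nonneg B))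
    _ = ‖B‖ / (‖B‖ + 1) * (ε * ‖f‖) := by ring
    _ ≤ 1 * (ε * ‖f‖) := mul_le_mul_of_nonneg_right
        ((div_le_one (by positivity)).2 (by linarith)) (by positivity)
    _ = ε * ‖f‖ := one_mul _

/-- The functionals in `KernelBound` need not be continuous, so their common kernel need not be
closed; the bound survives passage to the closure. -/
theorem norm_le_of_mem_topologicalClosure {A : H →L[ℂ] K} {σ : ℝ} {M : Submodule ℂ H}
    (h : ∀ f ∈ M, ‖A f‖ ≤ σ * ‖f‖) : ∀ f ∈ M.topologicalClosure, ‖A f‖ ≤ σ * ‖f‖ := by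
  intro f hf
  have hcl : IsClosed {f | ‖A f‖ ≤ σ * ‖f‖} := isClosed_le (by fun_prop) (by fun_prop)
  exact closure_minimal (s := (M : Set H)) h hcl hf

/-- `Λ` is injective on the orthogonal complement of its kernel `M`, so `Mᗮ` is finite-dimensional.
Composing `A` with the projection onto `Mᗮ` has finite rank, and the error is `A` on `Mᗮᗮ`, the
closure of `M`, where `A` is small. -/
theorem SmallOnFiniteCodim.isCompactOperator [CompleteSpace H] [CompleteSpace K] {A : H →L[ℂ] K}
    (hA : SmallOnFiniteCodim A) : IsCompactOperator A := by
  refine isClosed_setOfPred_isCompactOperator.closure_subset_iff.2 (Set.Subset.refl _)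
    (Metric.mem_closure_iff.2 fun ε hε => ?_)
  obtain ⟨_, m, _, Λ, hΛ⟩ := hA (ε / 2) (by positivity)
  set M := LinearMap.ker Λ
  have hfd : FiniteDimensional ℂ Mᗮ := by
    refine FiniteDimensional.of_injective (Λ.comp Mᗮ.subtype) ?_
    rw [← LinearMap.ker_eq_bot, LinearMap.ker_eq_bot']
    intro x hx
    have h1 : (x : H) ∈ M := hx
    exact Subtype.ext (Submodule.disjoint_def.1 M.orthogonal_disjoint x h1 x.2)
  refine ⟨A.comp (Mᗮ.subtypeL.comp Mᗮ.orthogonalProjectionOnto), ?_, ?_⟩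
  · have h1 : IsCompactOperator (A.comp Mᗮ.subtypeL) :=
      have : ProperSpace Mᗮ := FiniteDimensional.proper ℂ Mᗮ
      isCompactOperator_of_locallyCompactSpace_rng (A.comp Mᗮ.subtypeL)
    exact h1.comp_clm Mᗮ.orthogonalProjectionOnto
  · rw [dist_eq_norm]
    refine lt_of_le_of_lt (ContinuousLinearMap.opNorm_le_bound _ (by positivity) fun f => ?_)
      (half_lt_self hε)
    set q : H := f - Mᗮ.starProjection f
    have hq : q ∈ M.topologicalClosure := by
      rw [← Submodule.orthogonal_orthogonal_eq_closure]
      exact Submodule.sub_starProjection_mem_orthogonal f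
    have h2 := norm_le_of_mem_topologicalClosure (fun f hf => hΛ f hf) q hq
    have h3 : ‖q‖ ≤ ‖f‖ := by
      have h4 := Submodule.norm_sq_eq_add_norm_sq_starProjection f Mᗮ
      have h5 : q = Mᗮᗮ.starProjection f := by
        rw [Submodule.starProjection_orthogonal_val]
      rw [← h5] at h4
      nlinarith [norm_nonneg q, norm_nonneg f, norm_nonneg (Mᗮ.starProjection f)]
    calc _ = ‖A q‖ := by
          congr 1
          simp [q]
      _ ≤ ε / 2 * ‖q‖ := h2
      _ ≤ ε / 2 * ‖f‖ := mul_le_mul_of_nonneg_left h3 (by positivity)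

/-- Weyl's estimate on a finite-dimensional invariant subspace. -/
theorem pow_finrank_le_prod {T : H →L[ℂ] H} {ε : ℝ} (hε : 0 ≤ ε) (W : Submodule ℂ H)
    [FiniteDimensional ℂ W] (hW : ∀ y ∈ W, T y ∈ W)
    (hle : W ≤ genEigenspaceSum (T : Module.End ℂ H) {μ | ε ≤ ‖μ‖}) {σ : ℕ → ℝ}
    (hσ : ∀ i, KernelBound T i (σ i)) :
    ε ^ Module.finrank ℂ W ≤ ∏ i ∈ Finset.range (Module.finrank ℂ W), σ i := by
  set B : W →ₗ[ℂ] W := (T : H →ₗ[ℂ] H).restrict hW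
  -- By independence of generalised eigenspaces, an eigenvector inside the sum over `|μ| ≥ ε` cannot
  -- have a smaller eigenvalue.
  have h1 : ε ^ Module.finrank ℂ W ≤ ‖LinearMap.det B‖ := by
    refine pow_le_norm_det hε fun μ hμ => ?_
    obtain ⟨x, hx⟩ := hμ.exists_hasEigenvector
    by_contra hlt
    have h2 : (T : H →ₗ[ℂ] H) (x : H) = μ • (x : H) := congrArg Subtype.val hx.apply_eq_smul
    exact hx.2 (Subtype.ext (eq_zero_of_mem_genEigenspaceSum (S := {μ | ε ≤ ‖μ‖}) hlt h2
      (hle x.2)))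
  rw [← LinearMap.normDet_eq_norm_det, LinearMap.normDet_eq_prod_singularValues] at h1
  refine h1.trans (Finset.prod_le_prod (fun i _ => B.singularValues_nonneg i) fun i hi => ?_)
  obtain ⟨m, hm, Λ, hΛ⟩ := hσ i
  exact singularValues_le_of_kernel (Finset.mem_range.1 hi) hm (Λ.comp W.subtype)
    fun x hx => hΛ x hx

/-- If `T` is bounded by `ε/2` in codimension `m`, an invariant `W` of dimension `k ≥ m` satisfies
`ε^k ≤ ‖T‖^m (ε/2)^{k-m}`, that is `2^{k-m} ≤ (‖T‖/ε)^m`, which bounds `k`. -/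
theorem SmallOnFiniteCodim.rieszOperator {T : H →L[ℂ] H} (hT : SmallOnFiniteCodim T) :
    RieszOperator T := by
  intro ε hε
  obtain ⟨m, hm⟩ := hT (ε / 2) (by positivity)
  obtain ⟨p, hp⟩ := pow_unbounded_of_one_lt ((‖T‖ / ε) ^ m) one_lt_two
  refine finiteDimensional_genEigenspaceSum (m + p) fun W hf hi hl => ?_
  by_contra hlt
  push Not at hlt
  have h1 := pow_finrank_le_prod hε.le W hi hl (σ := fun i => if i < m then ‖T‖ else ε / 2)
    fun i => by
      by_cases h : i < m
      · simp only [h, if_true]; exact kernelBound_opNorm T i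
      · simp only [h, if_false]; exact hm.mono (not_lt.1 h) le_rfl
  obtain ⟨q, hq⟩ := Nat.exists_eq_add_of_lt hlt
  have hk : Module.finrank ℂ W = m + (p + q + 1) := by omega
  rw [hk, Finset.prod_range_add] at h1
  have h2 : ∏ i ∈ Finset.range m, (if i < m then ‖T‖ else ε / 2) = ‖T‖ ^ m := by
    rw [Finset.prod_congr rfl fun i hi => if_pos (Finset.mem_range.1 hi)]
    simp
  have h3 : ∏ i ∈ Finset.range (p + q + 1), (if m + i < m then ‖T‖ else ε / 2) =
      (ε / 2) ^ (p + q + 1) := by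
    rw [Finset.prod_congr rfl fun i _ => if_neg (by omega)]
    rw [Finset.prod_const, Finset.card_range]
  rw [h2, h3, pow_add, div_pow ε 2, mul_div_assoc', le_div_iff₀ (by positivity)] at h1
  have h4 : ε ^ m * 2 ^ (p + q + 1) ≤ ‖T‖ ^ m := by
    refine le_of_mul_le_mul_right ?_ (show 0 < ε ^ (p + q + 1) by positivity)
    linarith
  have h5 : (2 : ℝ) ^ (p + q + 1) ≤ (‖T‖ / ε) ^ m := by
    rw [div_pow, le_div_iff₀ (by positivity)]
    linarith
  have h6 : (2 : ℝ) ^ p ≤ 2 ^ (p + q + 1) := pow_le_pow_right₀ one_le_two (by omega)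
  linarith

/-- Existence is what makes the arbitrary choice in `eigenvalues`, and hence `singularValue`,
meaningful. -/
theorem SmallOnFiniteCodim.isEigenvalueSequence_eigenvalues {T : H →L[ℂ] H}
    (hT : SmallOnFiniteCodim T) : IsEigenvalueSequence T (eigenvalues T) :=
  Classical.epsilon_spec hT.rieszOperator.exists_isEigenvalueSequence

variable [CompleteSpace H] [CompleteSpace K]

theorem re_inner_adjoint_comp (A : H →L[ℂ] K) (x : H) :
    (inner ℂ ((ContinuousLinearMap.adjoint A).comp A x) x).re = ‖A x‖ ^ 2 := by
  rw [ContinuousLinearMap.comp_apply, ContinuousLinearMap.adjoint_inner_left,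
    ← RCLike.re_eq_complex_re, inner_self_eq_norm_sq]

theorem isSymmetric_adjoint_comp (A : H →L[ℂ] K) :
    (((ContinuousLinearMap.adjoint A).comp A : H →L[ℂ] H) : H →ₗ[ℂ] H).IsSymmetric := by
  intro x y
  change inner ℂ (ContinuousLinearMap.adjoint A (A x)) y =
    inner ℂ x (ContinuousLinearMap.adjoint A (A y))
  rw [ContinuousLinearMap.adjoint_inner_left, ContinuousLinearMap.adjoint_inner_right]

theorem eigenvalue_adjoint_comp {A : H →L[ℂ] K} {μ : ℂ} {x : H} (hx : x ≠ 0)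
    (h : (ContinuousLinearMap.adjoint A).comp A x = μ • x) : μ = (‖μ‖ : ℂ) := by
  have h1 : (inner ℂ x ((ContinuousLinearMap.adjoint A).comp A x) : ℂ) = (‖A x‖ : ℂ) ^ 2 := by
    rw [ContinuousLinearMap.comp_apply, ContinuousLinearMap.adjoint_inner_right,
      inner_self_eq_norm_sq_to_K]
    rfl
  rw [h, inner_smul_right, inner_self_eq_norm_sq_to_K] at h1
  have hx0 : (‖x‖ : ℝ) ≠ 0 := norm_ne_zero_iff.2 hx
  have h2 : μ = ((‖A x‖ ^ 2 / ‖x‖ ^ 2 : ℝ) : ℂ) := by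
    push_cast
    rw [eq_div_iff (pow_ne_zero 2 (by exact_mod_cast hx0))]
    exact h1
  have h3 : ‖μ‖ = ‖A x‖ ^ 2 / ‖x‖ ^ 2 := by
    rw [h2, Complex.norm_real, Real.norm_of_nonneg (by positivity)]
  rw [h3]
  exact h2

variable {A : H →L[ℂ] K}

theorem singularValue_nonneg (A : H →L[ℂ] K) (n : ℕ) : 0 ≤ singularValue A n :=
  Real.sqrt_nonneg _

/-- The upper half of minimax: on the spectral subspace `E` of `A* A` for `|μ| ≥ r`, of dimension at
least `n + 1`, one has `r ‖x‖² ≤ ‖A x‖²`, and at most `n` conditions leave a nonzero vector in `E`.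
-/
theorem SmallOnFiniteCodim.singularValue_le (hA : SmallOnFiniteCodim A) {n : ℕ} {σ : ℝ}
    (hσ : 0 ≤ σ) (h : KernelBound A n σ) : singularValue A n ≤ σ := by
  set P := (ContinuousLinearMap.adjoint A).comp A with hP
  have hPs : SmallOnFiniteCodim P := hA.comp_left _
  have hR := hPs.rieszOperator
  have hlam := hPs.isEigenvalueSequence_eigenvalues
  by_cases h0 : eigenvalues P n = 0
  · simpa [singularValue, ← hP, h0] using hσ
  have hpos : 0 < ‖eigenvalues P n‖ := norm_pos_iff.2 h0
  set r := ‖eigenvalues P n‖ with hr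
  set E := genEigenspaceSum (P : Module.End ℂ H) {μ | r ≤ ‖μ‖} with hE
  have hfd : FiniteDimensional ℂ E := hR r hpos
  have hdim : n + 1 ≤ Module.finrank ℂ E := hlam.succ_le_finrank hR h0
  have hinv : ∀ x ∈ E, (P : H →ₗ[ℂ] H) x ∈ E := apply_mem_genEigenspaceSum
  set B : E →ₗ[ℂ] E := (P : H →ₗ[ℂ] H).restrict hinv
  have hB : B.IsSymmetric := (isSymmetric_adjoint_comp A).restrict_invariant hinv
  have hβ : ∀ i, r ≤ hB.eigenvalues rfl i := by
    intro i
    obtain ⟨x, hx⟩ := (hB.hasEigenvalue_eigenvalues rfl i).exists_hasEigenvector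
    have h1 : (P : H →ₗ[ℂ] H) (x : H) = ((hB.eigenvalues rfl i : ℝ) : ℂ) • (x : H) :=
      congrArg Subtype.val hx.apply_eq_smul
    have hx0 : (x : H) ≠ 0 := fun h => hx.2 (Subtype.ext h)
    have h2 : r ≤ ‖((hB.eigenvalues rfl i : ℝ) : ℂ)‖ := by
      by_contra hlt
      exact hx0 (eq_zero_of_mem_genEigenspaceSum (S := {μ | r ≤ ‖μ‖}) hlt h1 x.2)
    have h3 := congrArg Complex.re (eigenvalue_adjoint_comp hx0 h1)
    rw [Complex.ofReal_re, Complex.ofReal_re] at h3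
    rw [h3]
    exact h2
  obtain ⟨m, hm, Λ, hΛ⟩ := h
  have hker : LinearMap.ker (Λ.comp E.subtype) ≠ ⊥ := by
    refine LinearMap.ker_ne_bot_of_finrank_lt ?_
    rw [Module.finrank_fintype_fun_eq_card, Fintype.card_fin]
    omega
  obtain ⟨x, hx, hx0⟩ := Submodule.exists_mem_ne_zero_of_ne_bot hker
  have h4 : ‖A x‖ ≤ σ * ‖(x : H)‖ := hΛ x hx
  have h5 : (inner ℂ (B x) x).re = ‖A x‖ ^ 2 := re_inner_adjoint_comp A x
  rw [re_inner_eq_sum_eigenvalues hB rfl] at h5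
  have h6 : r * ‖x‖ ^ 2 ≤ ‖A x‖ ^ 2 := by
    rw [← h5, ← (hB.eigenvectorBasis rfl).sum_sq_norm_inner_right x, Finset.mul_sum]
    exact Finset.sum_le_sum fun i _ => mul_le_mul_of_nonneg_right (hβ i) (by positivity)
  have h7 : ‖A x‖ ^ 2 ≤ σ ^ 2 * ‖x‖ ^ 2 := by
    rw [← mul_pow]; exact pow_le_pow_left₀ (norm_nonneg _) h4 2
  have h8 : r ≤ σ ^ 2 := le_of_mul_le_mul_right (h6.trans h7) (by
    have := norm_pos_iff.2 hx0; positivity)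
  exact Real.sqrt_le_iff.2 ⟨hσ, (Complex.re_le_norm _).trans h8⟩

/-- `singularValue` takes the real part of an eigenvalue; nothing is lost, since a nonzero entry of
the sequence has a genuine eigenvector and `⟨x, A* A x⟩ = ‖A x‖²` makes it positive. -/
theorem SmallOnFiniteCodim.sqrt_norm_eigenvalues (hA : SmallOnFiniteCodim A) (n : ℕ) :
    singularValue A n ^ 2 = ‖eigenvalues ((ContinuousLinearMap.adjoint A).comp A) n‖ := by
  set P := (ContinuousLinearMap.adjoint A).comp A with hP
  have hPs : SmallOnFiniteCodim P := hA.comp_left _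
  have hlam := hPs.isEigenvalueSequence_eigenvalues
  have h1 : eigenvalues P n = (‖eigenvalues P n‖ : ℂ) := by
    by_cases h0 : eigenvalues P n = 0
    · simp [h0]
    · have hne : Module.End.maxGenEigenspace (P : Module.End ℂ H) (eigenvalues P n) ≠ ⊥ := by
        intro hbot
        have h2 := hlam.multiplicity _ h0
        rw [hbot, rank_bot, map_zero, Set.encard_eq_zero] at h2
        exact Set.notMem_empty n (h2 ▸ (rfl : eigenvalues P n = eigenvalues P n))
      have hev : Module.End.HasEigenvalue (P : Module.End ℂ H) (eigenvalues P n) := by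
        rw [Module.End.hasEigenvalue_iff]
        intro hbot
        refine hne (eq_bot_iff.2 fun x hx => ?_)
        obtain ⟨k, hk⟩ := (Module.End.mem_maxGenEigenspace _ _ x).1 hx
        have hinj : Function.Injective
            ((P : Module.End ℂ H) - eigenvalues P n • (1 : Module.End ℂ H)) := by
          rw [← LinearMap.ker_eq_bot]
          rw [Module.End.eigenspace_def] at hbot
          exact hbot
        have h3 : Function.Injective
            (((P : Module.End ℂ H) - eigenvalues P n • (1 : Module.End ℂ H)) ^ k) := by
          rw [Module.End.coe_pow]
          exact hinj.iterate k
        exact h3 (hk.trans (map_zero _).symm)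
      obtain ⟨x, hx⟩ := hev.exists_hasEigenvector
      exact eigenvalue_adjoint_comp hx.2 hx.apply_eq_smul
  have h2 := congrArg Complex.re h1
  rw [Complex.ofReal_re] at h2
  rw [singularValue, ← hP, h2, Real.sq_sqrt (norm_nonneg _)]

/-- The converse half of minimax. On the complement of the eigenvectors with `|μ| > r`, `A* A` is
compact and self-adjoint without eigenvalues of modulus above `r`; its norm equals its spectral
radius, so it is at most `r`. -/
theorem SmallOnFiniteCodim.kernelBound_singularValue (hA : SmallOnFiniteCodim A) (n : ℕ) :
    KernelBound A n (singularValue A n) := by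
  set P := (ContinuousLinearMap.adjoint A).comp A with hP
  have hPs : SmallOnFiniteCodim P := hA.comp_left _
  have hlam := hPs.isEigenvalueSequence_eigenvalues
  have hs := hA.sqrt_norm_eigenvalues n
  rw [← hP] at hs
  set r := ‖eigenvalues P n‖
  set E := genEigenspaceSum (P : Module.End ℂ H) {μ | r < ‖μ‖} with hE
  obtain ⟨hfd, hdim⟩ := hlam.finrank_le hPs.rieszOperator n
  change FiniteDimensional ℂ E at hfd
  change Module.finrank ℂ E ≤ n at hdim
  have hsymm := isSymmetric_adjoint_comp A
  rw [← hP] at hsymm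
  have hinv : ∀ x ∈ Eᗮ, (P : H →ₗ[ℂ] H) x ∈ Eᗮ := by
    intro x hx
    rw [Submodule.mem_orthogonal] at hx ⊢
    intro u hu
    rw [← hsymm u x]
    exact hx _ (apply_mem_genEigenspaceSum u hu)
  let Q : Eᗮ →L[ℂ] Eᗮ := P.restrict hinv
  have hQc : IsCompactOperator Q := hPs.isCompactOperator.restrict' (f := (P : H →ₗ[ℂ] H)) hinv
  have hQs : IsSelfAdjoint Q := by
    rw [ContinuousLinearMap.isSelfAdjoint_iff_isSymmetric]
    exact hsymm.restrict_invariant hinv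
  have hnorm : ‖Q‖ ≤ r := by
    by_contra hlt
    push Not at hlt
    have h1 : ENNReal.ofReal r < spectralRadius ℂ Q := by
      rw [Q.spectralRadius_eq_nnnorm hQs, ENNReal.ofReal_lt_coe_iff (norm_nonneg _)]
      exact hlt
    simp only [spectralRadius, lt_iSup_iff] at h1
    obtain ⟨k, hk, h2⟩ := h1
    rw [ENNReal.ofReal_lt_coe_iff (norm_nonneg _)] at h2
    have h3 : r < ‖k‖ := h2
    have hk0 : k ≠ 0 := norm_pos_iff.1 ((norm_nonneg _).trans_lt h3)
    obtain ⟨x, hx⟩ := ((hQc.hasEigenvalue_iff_mem_spectrum hk0).2 hk).exists_hasEigenvector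
    have h4 : (P : H →ₗ[ℂ] H) (x : H) = k • (x : H) := congrArg Subtype.val hx.apply_eq_smul
    have h5 : (x : H) ∈ E := by
      refine maxGenEigenspace_le_genEigenspaceSum (S := {μ | r < ‖μ‖}) h3 ?_
      rw [Module.End.mem_maxGenEigenspace]
      exact ⟨1, by simpa [sub_eq_zero] using h4⟩
    exact hx.2 (Subtype.ext (Submodule.disjoint_def.1 E.orthogonal_disjoint x h5 x.2))
  set b := stdOrthonormalBasis ℂ E
  -- Coordinates along an orthonormal basis of `E`: their common kernel is `Eᗮ`.
  refine ⟨Module.finrank ℂ E, hdim, LinearMap.pi fun i => innerₛₗ ℂ ((b i : E) : H),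
    fun f hf => ?_⟩
  have hfE : f ∈ Eᗮ := by
    rw [Submodule.mem_orthogonal]
    intro u hu
    have h1 := b.sum_repr ⟨u, hu⟩
    have h2 : u = ∑ i, (b.repr ⟨u, hu⟩) i • ((b i : E) : H) := by
      conv_lhs => rw [show u = ((⟨u, hu⟩ : E) : H) from rfl, ← h1]
      simp
    rw [h2, sum_inner]
    refine Finset.sum_eq_zero fun i _ => ?_
    have h3 : inner ℂ ((b i : E) : H) f = 0 := congrFun hf i
    rw [inner_smul_left, h3, mul_zero]
  have h6 : ‖A f‖ ^ 2 ≤ (singularValue A n * ‖f‖) ^ 2 := by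
    rw [← re_inner_adjoint_comp A f, mul_pow, hs]
    calc _ ≤ ‖inner ℂ (P f) f‖ := Complex.re_le_norm _
      _ ≤ ‖P f‖ * ‖f‖ := norm_inner_le_norm _ _
      _ ≤ (r * ‖f‖) * ‖f‖ := by
        refine mul_le_mul_of_nonneg_right ?_ (norm_nonneg f)
        exact (Q.le_opNorm ⟨f, hfE⟩).trans (mul_le_mul_of_nonneg_right hnorm (norm_nonneg _))
      _ = r * ‖f‖ ^ 2 := by ring
  exact le_of_sq_le_sq h6 (mul_nonneg (singularValue_nonneg A n) (norm_nonneg f))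

/-- Weyl's inequality between eigenvalues and singular values. -/
theorem IsEigenvalueSequence.exists_pow_le_prod {T : H →L[ℂ] H} (hT : SmallOnFiniteCodim T)
    {lam : ℕ → ℂ} (hlam : IsEigenvalueSequence T lam) {n : ℕ} (hn : lam n ≠ 0) :
    ∃ k, n + 1 ≤ k ∧ ‖lam n‖ ^ k ≤ ∏ i ∈ Finset.range k, singularValue T i := by
  have hR := hT.rieszOperator
  have := hR ‖lam n‖ (norm_pos_iff.2 hn)
  exact ⟨_, hlam.succ_le_finrank hR hn, pow_finrank_le_prod (norm_nonneg _) _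
    apply_mem_genEigenspaceSum le_rfl hT.kernelBound_singularValue⟩

end SingularValues

/-! ### Point evaluations with explicit constants. -/

section PointEvaluation

theorem eLpNorm_two_sq {α ε : Type*} [MeasurableSpace α] [ENorm ε] (f : α → ε) (μ : Measure α) :
    eLpNorm f 2 μ ^ 2 = ∫⁻ x, ‖f x‖ₑ ^ 2 ∂μ := by
  rw [eLpNorm_eq_lintegral_rpow_enorm_toReal (by simp) (by simp)]
  simp only [ENNReal.toReal_ofNat, ENNReal.rpow_ofNat, one_div]
  rw [← ENNReal.rpow_natCast, ← ENNReal.rpow_mul]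
  simp

theorem eLpNorm_two_mul_const {α : Type*} [MeasurableSpace α] (b : α → ℝ≥0∞) {c : ℝ≥0∞}
    (hc : c ≠ ∞) (μ : Measure α) :
    eLpNorm (fun x => b x * c) 2 μ = eLpNorm b 2 μ * c := by
  have h : eLpNorm (fun x => b x * c) 2 μ ^ 2 = (eLpNorm b 2 μ * c) ^ 2 := by
    rw [mul_pow, eLpNorm_two_sq, eLpNorm_two_sq,
      ← lintegral_mul_const' _ _ (ENNReal.pow_ne_top hc)]
    simp only [enorm_eq_self, mul_pow]
  exact le_antisymm ((ENNReal.pow_le_pow_left_iff two_ne_zero).1 h.le)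
    ((ENNReal.pow_le_pow_left_iff two_ne_zero).1 h.ge)

variable {d : ℕ}

theorem V_ball_zero {r : ℝ} (hr : 0 < r) : V d (ball 0 r) = ENNReal.ofReal (r ^ d) ^ 2 := by
  rw [Measure.addHaar_ball_of_pos (V d) 0 hr, V_unitBall, mul_one, finrank_real_CSpace,
    ← ENNReal.ofReal_pow (by positivity), ← pow_mul, mul_comm]

/-- Point evaluation on the Bergman space of a ball, with the sharp constant. -/
theorem A2.enorm_apply_le {Ω : Opens (CSpace d)} (f : A2 Ω) {Ωt : Opens (CSpace d)}
    (hsub : (Ωt : Set (CSpace d)) ⊆ Ω) {z : CSpace d} {r : ℝ} (hr : 0 < r) (hz : ball z r ⊆ Ωt) :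
    ‖f z‖ₑ ≤ ENNReal.ofReal ((r ^ d)⁻¹) * eLpNorm f 2 ((V d).restrict Ωt) := by
  have h1 : ‖f z‖ₑ ^ 2 * V d (ball 0 r) ≤ eLpNorm f 2 ((V d).restrict Ωt) ^ 2 := by
    calc ‖f z‖ₑ ^ 2 * V d (ball 0 r) = ‖f z ^ 2‖ₑ * V d (ball 0 r) := by rw [enorm_pow]
      _ ≤ ∫⁻ v in ball 0 r, ‖f (z + v) ^ 2‖ₑ ∂(V d) :=
          enorm_mul_le_lintegral (h := fun z => f z ^ 2) (f.measurable.pow_const 2)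
            ((f.differentiableOn.mono (hz.trans hsub)).pow 2)
      _ = ∫⁻ v in ball z r, ‖f v ^ 2‖ₑ ∂(V d) := by
          have h3 := (measurePreserving_add_left (V d) z).setLIntegral_comp_preimage
            (s := ball z r) measurableSet_ball (f := fun v => ‖f v ^ 2‖ₑ)
            (f.measurable.pow_const 2).enorm
          rw [← h3]
          congr 2
          ext v; simp
      _ ≤ ∫⁻ v in Ωt, ‖f v ^ 2‖ₑ ∂(V d) := lintegral_mono_set hz
      _ = _ := by simp only [eLpNorm_two_sq, enorm_pow]
  rw [V_ball_zero hr, ← mul_pow, ENNReal.pow_le_pow_left_iff two_ne_zero] at h1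
  have hrd : 0 < r ^ d := by positivity
  rw [ENNReal.ofReal_inv_of_pos hrd, mul_comm, ← div_eq_mul_inv]
  refine (ENNReal.le_div_iff_mul_le (Or.inl ?_) (Or.inl ENNReal.ofReal_ne_top)).2 h1
  simpa using hrd

theorem A2.norm_apply_le_exists {Ω : Opens (CSpace d)} {z : CSpace d} (hz : z ∈ Ω) :
    ∃ C : ℝ, ∀ f : A2 Ω, ‖f z‖ ≤ C * ‖f‖ := by
  obtain ⟨r, hr, hsub⟩ := Metric.isOpen_iff.1 Ω.isOpen z hz
  obtain ⟨C, _, hC⟩ := A2.exists_norm_apply_le d hr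
  exact ⟨C, fun f => hC Ω f z hsub⟩

theorem A2.hasSum_apply {Ω : Opens (CSpace d)} {I : Type*} {u : I → A2 Ω} {f : A2 Ω}
    (h : HasSum u f) {z : CSpace d} (hz : z ∈ Ω) : HasSum (fun i => u i z) (f z) := by
  obtain ⟨C, hC⟩ := A2.norm_apply_le_exists hz
  let ev : A2 Ω →L[ℂ] ℂ := LinearMap.mkContinuous
    { toFun := fun f => f z, map_add' := fun _ _ => rfl, map_smul' := fun _ _ => rfl } C hC
  exact h.mapL ev

theorem A2.sum_apply {Ω : Opens (CSpace d)} {I : Type*} (t : Finset I) (u : I → A2 Ω)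
    (z : CSpace d) : (∑ i ∈ t, u i) z = ∑ i ∈ t, u i z := by
  classical
  induction t using Finset.induction_on with
  | empty => rfl
  | insert a t ha ih => rw [Finset.sum_insert ha, Finset.sum_insert ha, A2.add_apply, ih]

end PointEvaluation

/-! ### Distance to the frontier. -/

section Distance

/-- The ball is connected and misses the frontier, so it stays on the side of its centre. -/
theorem ball_subset_of_le_setDist {E : Type*} [NormedAddCommGroup E] [NormedSpace ℝ E]
    {A U : Set E} (hU : IsOpen U) {z : E} (hz : z ∈ A) (hzU : z ∈ U) {r : ℝ}
    (hr : r ≤ setDist A (frontier U)) : ball z r ⊆ U := by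
  rcases le_or_gt r 0 with h0 | h0
  · rw [ball_eq_empty.2 h0]; exact Set.empty_subset _
  have hsub : ball z r ⊆ U ∪ (closure U)ᶜ := by
    intro y hy
    by_cases hyU : y ∈ U
    · exact Or.inl hyU
    · refine Or.inr fun hyc => ?_
      have hyf : y ∈ frontier U := by
        rw [hU.frontier_eq]; exact ⟨hyc, hyU⟩
      have h1 : setDist A (frontier U) ≤ dist z y :=
        csInf_le ⟨0, by rintro _ ⟨a, _, b, _, rfl⟩; exact dist_nonneg⟩ ⟨z, hz, y, hyf, rfl⟩
      rw [mem_ball, dist_comm] at hy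
      linarith
  exact (convex_ball z r).isPreconnected.subset_left_of_subset_union hU isClosed_closure.isOpen_compl
    (Set.disjoint_compl_right_iff_subset.2 subset_closure) hsub ⟨z, mem_ball_self h0, hzU⟩

/-- `setDist` to an empty set would be `sInf ∅ = 0`. The frontier is nonempty because a nontrivial
real normed space is not compact, so `U` cannot be everything. Compactness of the closure of `B`
then separates it from the frontier uniformly over all `A ⊆ B`. -/
theorem exists_pos_le_setDist {E : Type*} [NormedAddCommGroup E] [NormedSpace ℝ E] [Nontrivial E]
    {B U : Set E} (hU : IsOpen U) (hne : U.Nonempty) (hUc : IsCompact (closure U))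
    (hB : CompactlyContained B U) :
    ∃ δ > 0, ∀ A ⊆ B, A.Nonempty → δ ≤ setDist A (frontier U) := by
  have : NoncompactSpace E := NormedSpace.noncompactSpace ℝ E
  have hfr : (frontier U).Nonempty := by
    rw [nonempty_frontier_iff]
    refine ⟨hne, fun h => ?_⟩
    rw [h, closure_univ] at hUc
    exact noncompact_univ E hUc
  have hdis : Disjoint (closure B) (frontier U) :=
    (Set.disjoint_iff_inter_eq_empty.2 hU.inter_frontier_eq).mono_left hB.2
  obtain ⟨δ, hδ, hδ'⟩ := hdis.exists_thickenings hB.1 isClosed_frontier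
  refine ⟨δ, hδ, fun A hA hAne => le_csInf (hAne.image2 hfr) ?_⟩
  rintro _ ⟨a, ha, b, hb, rfl⟩
  by_contra hlt
  push Not at hlt
  refine Set.disjoint_left.1 hδ' (?_ : b ∈ _) (self_subset_thickening hδ _ hb)
  rw [mem_thickening_iff]
  exact ⟨a, subset_closure (hA ha), by rwa [dist_comm]⟩

end Distance

/-! ### Convergence of the transfer operator series. -/

namespace MapWeightSystem

variable {d : ℕ} {Ω : Opens (CSpace d)} {I : Type*}

/-- The transfer operator exists, and is bounded by an `L²` majorant of its weights times the norm
over a subdomain, if the evaluations at the points `φ i z` are bounded by that norm. -/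
theorem exists_isTransferOperator [Countable I] (S : MapWeightSystem Ω I) {Ωt : Opens (CSpace d)}
    (hsub : (Ωt : Set (CSpace d)) ⊆ Ω) (a : I → ℝ≥0∞)
    (ha : ∀ (f : A2 Ω) (i : I), ∀ z ∈ Ω,
      ‖f (S.φ i z)‖ₑ ≤ a i * eLpNorm f 2 ((V d).restrict Ωt))
    (hW : eLpNorm (fun z => ∑' i, ‖S.w i z‖ₑ * a i) 2 ((V d).restrict Ω) ≠ ∞) :
    ∃ L : A2 Ω →L[ℂ] A2 Ω, S.IsTransferOperator L ∧ ∀ f : A2 Ω, ‖L f‖ₑ ≤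
      eLpNorm (fun z => ∑' i, ‖S.w i z‖ₑ * a i) 2 ((V d).restrict Ω) *
        eLpNorm f 2 ((V d).restrict Ωt) := by
  classical
  set μ := (V d).restrict Ω
  set b : I → CSpace d → ℝ≥0∞ := fun i z => ‖S.w i z‖ₑ * a i with hb
  have hbm : ∀ i, Measurable (b i) := fun i => (S.w i).measurable.enorm.mul_const _
  set G : CSpace d → ℝ≥0∞ := fun z => ∑' i, b i z with hG
  have hGm : Measurable G := Measurable.tsum hbm
  have hG2 : ∫⁻ z, G z ^ 2 ∂μ ≠ ∞ := by
    have h := eLpNorm_two_sq G μ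
    simp only [enorm_eq_self] at h
    rw [← h]
    exact ENNReal.pow_ne_top hW
  have hN : ∀ f : A2 Ω, eLpNorm f 2 ((V d).restrict Ωt) ≤ ‖f‖ₑ := fun f => by
    rw [A2.enorm_def]
    exact eLpNorm_mono_measure _ (Measure.restrict_mono hsub le_rfl)
  have hNt : ∀ f : A2 Ω, eLpNorm f 2 ((V d).restrict Ωt) ≠ ∞ := fun f =>
    ((hN f).trans_lt enorm_lt_top).ne
  have hpart : ∀ (f : A2 Ω) (t : Finset I), ‖∑ i ∈ t, S.weightedComp i f‖ₑ ≤
      eLpNorm (fun z => ∑ i ∈ t, b i z) 2 μ * eLpNorm f 2 ((V d).restrict Ωt) := by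
    intro f t
    rw [A2.enorm_def, ← eLpNorm_two_mul_const _ (hNt f)]
    refine eLpNorm_mono_enorm_ae (ae_restrict_of_forall_mem Ω.isOpen.measurableSet fun z hz => ?_)
    rw [enorm_eq_self, Finset.sum_mul, A2.sum_apply]
    refine (enorm_sum_le _ _).trans (Finset.sum_le_sum fun i _ => ?_)
    rw [weightedComp_apply, enorm_mul, hb, mul_assoc]
    exact mul_le_mul_right (ha f i z hz) _
  -- the tails of the majorant tend to zero
  have htail : Tendsto (fun s : Finset I => ∫⁻ z, (∑' i : {i // i ∉ s}, b i z) ^ 2 ∂μ) atTop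
      (𝓝 0) := by
    have h1 := tendsto_lintegral_filter_of_dominated_convergence (μ := μ)
      (l := (atTop : Filter (Finset I))) (F := fun s z => (∑' i : {i // i ∉ s}, b i z) ^ 2)
      (f := fun _ => 0) (fun z => G z ^ 2)
      (Eventually.of_forall fun s =>
        (show Measurable fun z => ∑' i : {i // i ∉ s}, b i z from
          Measurable.tsum fun i => hbm i.1).pow_const 2)
      (Eventually.of_forall fun s => ae_of_all _ fun z => ENNReal.pow_le_pow_left
        (ENNReal.tsum_comp_le_tsum_of_injective Subtype.val_injective _)) hG2 ?_
    · simpa using h1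
    · filter_upwards [ae_lt_top (hGm.pow_const 2) hG2] with z hz
      have h2 : ∑' i, b i z ≠ ∞ := fun h => by
        simp only [hG, h] at hz
        simp at hz
      simpa using ENNReal.Tendsto.pow (n := 2) (ENNReal.tendsto_tsum_compl_atTop_zero h2)
  have hsummable : ∀ f : A2 Ω, Summable fun i => S.weightedComp i f := by
    intro f
    rw [summable_iff_vanishing_norm]
    intro ε hε
    set N := ‖f‖ + 1
    have hNpos : 0 < N := by positivity
    -- The tail is squared because it is measured by the squared `L²` norm; `N = ‖f‖ + 1` is
    -- positive even for `f = 0`.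
    obtain ⟨s, hs⟩ := (ENNReal.tendsto_nhds_zero.1 htail (ENNReal.ofReal ((ε / (2 * N)) ^ 2))
      (ENNReal.ofReal_pos.2 (by positivity))).exists
    refine ⟨s, fun t hts => ?_⟩
    have h1 : eLpNorm (fun z => ∑ i ∈ t, b i z) 2 μ ≤ ENNReal.ofReal (ε / (2 * N)) := by
      rw [← ENNReal.pow_le_pow_left_iff two_ne_zero, eLpNorm_two_sq,
        ← ENNReal.ofReal_pow (by positivity)]
      refine le_trans (lintegral_mono fun z => ?_) hs
      rw [enorm_eq_self]
      refine ENNReal.pow_le_pow_left ?_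
      have h2 : ∀ i ∈ t, i ∉ s := fun i hi => Finset.disjoint_left.1 hts hi
      calc ∑ i ∈ t, b i z = ∑ i ∈ t.attach, b i z := (Finset.sum_attach t fun i => b i z).symm
        _ = ∑ i ∈ t.attach.image fun i => (⟨i.1, h2 i.1 i.2⟩ : {i // i ∉ s}), b i z := by
            rw [Finset.sum_image]
            intro x _ y _ hxy
            exact Subtype.ext (congrArg (fun q => q.1) hxy)
        _ ≤ _ := ENNReal.sum_le_tsum _
    have h3 := (hpart f t).trans (mul_le_mul' h1 (hN f))
    rw [← ofReal_norm f, ← ENNReal.ofReal_mul (by positivity), ← ofReal_norm,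
      ENNReal.ofReal_le_ofReal_iff (by positivity)] at h3
    refine h3.trans_lt ?_
    calc ε / (2 * N) * ‖f‖ ≤ ε / (2 * N) * N :=
          mul_le_mul_of_nonneg_left (by simp [N]) (by positivity)
      _ = ε / 2 := by field_simp
      _ < ε := half_lt_self hε
  have hbound : ∀ f : A2 Ω, ‖∑' i, S.weightedComp i f‖ₑ ≤
      eLpNorm G 2 μ * eLpNorm f 2 ((V d).restrict Ωt) := by
    intro f
    refine le_of_tendsto ((hsummable f).hasSum.enorm) (Eventually.of_forall fun t => ?_)
    refine (hpart f t).trans (mul_le_mul_left (eLpNorm_mono_enorm fun z => ?_) _)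
    simp only [enorm_eq_self]
    exact ENNReal.sum_le_tsum t
  let L₀ : A2 Ω →ₗ[ℂ] A2 Ω :=
    { toFun := fun f => ∑' i, S.weightedComp i f
      map_add' := fun f g => by
        simp only [map_add]
        exact (hsummable f).tsum_add (hsummable g)
      map_smul' := fun c f => by
        simp only [map_smul, RingHom.id_apply]
        exact (hsummable f).tsum_const_smul c }
  let L : A2 Ω →L[ℂ] A2 Ω := L₀.mkContinuous (eLpNorm G 2 μ).toReal fun f => by
    have h1 := (hbound f).trans (mul_le_mul_right (hN f) _)
    have h2 := ENNReal.toReal_mono (ENNReal.mul_ne_top hW enorm_ne_top) h1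
    simp only [toReal_enorm, ENNReal.toReal_mul] at h2
    exact h2
  refine ⟨L, ⟨fun f => (hsummable f).hasSum, fun f z hz => ?_⟩, hbound⟩
  exact A2.hasSum_apply (hsummable f).hasSum hz

end MapWeightSystem

/-! ### Counting conditions and summing exponents. -/

section Counting

/-- The binomial grows by the factor `(k+d)/(d+1)` from `d` to `d + 1`, which is at most `k + d/2`
once `k ≥ 1`; the base of the power only increases as well. -/
theorem choose_le_pow {k : ℕ} (hk : 1 ≤ k) (d : ℕ) :
    ((k + d - 1).choose d : ℝ) ≤ (k + ((d : ℝ) - 1) / 2) ^ d := by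
  have hk' : (1 : ℝ) ≤ k := by exact_mod_cast hk
  induction d with
  | zero => simp
  | succ d ih =>
    have h1 := Nat.add_one_mul_choose_eq (k + d - 1) d
    rw [show k + d - 1 + 1 = k + (d + 1) - 1 by omega] at h1
    have h2 : ((k + (d + 1) - 1 : ℕ) : ℝ) = k + d := by
      rw [show k + (d + 1) - 1 = k + d by omega]; push_cast; ring
    have h3 : ((k : ℝ) + d) * ((k + d - 1).choose d : ℝ) =
        ((k + (d + 1) - 1).choose (d + 1) : ℝ) * (d + 1) := by
      rw [← h2]; exact_mod_cast h1
    have hd0 : (0 : ℝ) ≤ d := Nat.cast_nonneg d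
    have hpow : ((k : ℝ) + ((d : ℝ) - 1) / 2) ^ d ≤ (k + (((d + 1 : ℕ) : ℝ) - 1) / 2) ^ d := by
      refine pow_le_pow_left₀ (by linarith) ?_ d
      push_cast
      linarith
    have hlin : (k : ℝ) + d ≤ (k + (((d + 1 : ℕ) : ℝ) - 1) / 2) * (d + 1) := by
      push_cast
      nlinarith [mul_nonneg hd0 (sub_nonneg.2 hk'), mul_nonneg hd0 hd0]
    refine le_of_mul_le_mul_right ?_ (show (0 : ℝ) < d + 1 by linarith)
    rw [← h3, pow_succ, mul_assoc, mul_comm ((k : ℝ) + d)]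
    exact mul_le_mul (ih.trans hpow) hlin (by positivity) (pow_nonneg (by push_cast; linarith) d)

variable {N : ℕ} {Γ : Fin N → ℝ}

theorem gaugeNorm_pos (hN : 0 < N) (hΓ : ∀ j, 0 < Γ j) (d : ℕ) : 0 < gaugeNorm d Γ := by
  have : Nonempty (Fin N) := ⟨⟨0, hN⟩⟩
  exact Real.rpow_pos_of_pos (Finset.sum_pos
    (fun j _ => Real.rpow_pos_of_pos (abs_pos.2 (hΓ j).ne') _) Finset.univ_nonempty) _

theorem gaugeNorm_pow (hN : 0 < N) (hΓ : ∀ j, 0 < Γ j) {d : ℕ} (hd : 0 < d) :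
    gaugeNorm d Γ ^ d * ∑ j, ((Γ j)⁻¹) ^ d = 1 := by
  have : Nonempty (Fin N) := ⟨⟨0, hN⟩⟩
  have h1 : ∑ j, ((Γ j)⁻¹) ^ d = ∑ j, |Γ j| ^ (-(d : ℝ)) := Finset.sum_congr rfl fun j _ => by
    rw [abs_of_pos (hΓ j), Real.rpow_neg (hΓ j).le, Real.rpow_natCast, inv_pow]
  have hpos : 0 < ∑ j, |Γ j| ^ (-(d : ℝ)) := Finset.sum_pos
    (fun j _ => Real.rpow_pos_of_pos (abs_pos.2 (hΓ j).ne') _) Finset.univ_nonempty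
  have hd' : (d : ℝ) ≠ 0 := by exact_mod_cast hd.ne'
  rw [h1, gaugeNorm, ← Real.rpow_natCast, ← Real.rpow_mul hpos.le,
    show -(1 / (d : ℝ)) * d = -1 by field_simp, Real.rpow_neg_one, inv_mul_cancel₀ hpos.ne']

/-- The choice of vanishing orders at the centres of a relative cover. -/
theorem exists_vanishing_orders (hN : 0 < N) (hΓ : ∀ j, 0 < Γ j) {d : ℕ} (hd : 0 < d) {n : ℕ}
    (hn : 0 < n) :
    ∃ k : Fin N → ℕ, ∑ j, (k j + d - 1).choose d < n ∧ ∀ j,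
      gaugeNorm d Γ * (n : ℝ) ^ (1 / (d : ℝ)) + ((d : ℝ) - 1) / 2 * Γ j ≤ Γ j * (k j + d) := by
  have : Nonempty (Fin N) := ⟨⟨0, hN⟩⟩
  set x : ℝ := gaugeNorm d Γ * (n : ℝ) ^ (1 / (d : ℝ)) with hx
  have hn' : (0 : ℝ) < n := by exact_mod_cast hn
  have hd1 : (1 : ℝ) ≤ d := by exact_mod_cast hd
  have hxpos : 0 < x := mul_pos (gaugeNorm_pos hN hΓ d) (Real.rpow_pos_of_pos hn' _)
  have hxd : x ^ d = gaugeNorm d Γ ^ d * n := by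
    rw [hx, mul_pow, ← Real.rpow_natCast ((n : ℝ) ^ (1 / (d : ℝ))), ← Real.rpow_mul hn'.le,
      one_div, inv_mul_cancel₀ (by positivity), Real.rpow_one]
  have hsum : ∑ j, (x / Γ j) ^ d = n := by
    simp only [div_eq_mul_inv, mul_pow]
    rw [← Finset.mul_sum, hxd, mul_right_comm]
    rw [gaugeNorm_pow hN hΓ hd, one_mul]
  -- The shift is `1 + (d-1)/2`: rounding up costs less than `1`, so `k + (d-1)/2 < x / Γ j` when `k
  -- > 0`. Adding `d` to `k` afterwards leaves the surplus `(d-1)/2`.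
  refine ⟨fun j => ⌈x / Γ j - (d + 1) / 2⌉₊, ?_, fun j => ?_⟩
  · have h1 : ∑ j, ((⌈x / Γ j - ((d : ℝ) + 1) / 2⌉₊ + d - 1).choose d : ℝ) <
        ∑ j, (x / Γ j) ^ d := by
      refine Finset.sum_lt_sum_of_nonempty Finset.univ_nonempty fun j _ => ?_
      have hxj : 0 < x / Γ j := div_pos hxpos (hΓ j)
      set k := ⌈x / Γ j - ((d : ℝ) + 1) / 2⌉₊ with hk
      rcases Nat.eq_zero_or_pos k with h0 | h0
      -- For `k = 0` there are no conditions, and `x / Γ j` may be smaller than `(d-1)/2`, so this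
      -- case is separate.
      · rw [h0, Nat.choose_eq_zero_of_lt (by omega), Nat.cast_zero]
        positivity
      · have h2 : (k : ℝ) < x / Γ j - ((d : ℝ) + 1) / 2 + 1 :=
          Nat.ceil_lt_add_one (Nat.ceil_pos.1 h0).le
        refine (choose_le_pow h0 d).trans_lt ?_
        have hk1 : (1 : ℝ) ≤ k := by exact_mod_cast h0
        exact pow_lt_pow_left₀ (by linarith) (by linarith) hd.ne'
    rw [hsum] at h1
    exact_mod_cast h1
  · have h1 := Nat.le_ceil (x / Γ j - ((d : ℝ) + 1) / 2)
    have h2 : x / Γ j + ((d : ℝ) - 1) / 2 ≤ (⌈x / Γ j - ((d : ℝ) + 1) / 2⌉₊ : ℝ) + d := by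
      linarith
    have h3 := mul_le_mul_of_nonneg_left h2 (hΓ j).le
    rw [mul_add, mul_div_cancel₀ _ (hΓ j).ne'] at h3
    linarith

/-- A discrete form of `∫₀ᵏ (p+1) t^p dt = k^{p+1}`; each increment is Bernoulli's inequality at
`-1/(k+1)`. -/
theorem rpow_le_sum_rpow {p : ℝ} (hp : 0 ≤ p) (k : ℕ) :
    (k : ℝ) ^ (p + 1) ≤ (p + 1) * ∑ i ∈ Finset.range k, ((i : ℝ) + 1) ^ p := by
  induction k with
  | zero => simp [Real.zero_rpow (by linarith : p + 1 ≠ 0)]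
  | succ k ih =>
    rw [Finset.sum_range_succ, mul_add]
    have hk : (0 : ℝ) < (k : ℝ) + 1 := by positivity
    have h1 := one_add_mul_self_le_rpow_one_add (s := -((k : ℝ) + 1)⁻¹) (p := p + 1)
      (by rw [neg_le_neg_iff]; exact inv_le_one_of_one_le₀ (by linarith)) (by linarith)
    have h2 : 1 + -((k : ℝ) + 1)⁻¹ = k / (k + 1) := by field_simp; ring
    rw [h2, Real.div_rpow (by positivity) hk.le, le_div_iff₀ (Real.rpow_pos_of_pos hk _)] at h1
    have h3 : ((k : ℝ) + 1) ^ (p + 1) = (k + 1) ^ p * (k + 1) := Real.rpow_add_one hk.ne' p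
    have h4 : (1 + (p + 1) * -((k : ℝ) + 1)⁻¹) * ((k : ℝ) + 1) ^ (p + 1) =
        ((k : ℝ) + 1) ^ (p + 1) - (p + 1) * (k + 1) ^ p := by
      rw [h3]; field_simp; ring
    rw [h4] at h1
    push_cast
    linarith

/-- Stretched exponential decay of geometric means. -/
theorem le_of_pow_le_prod {d : ℕ} (hd : 0 < d) {c G t : ℝ} (hc : 0 ≤ c) (hG : 0 ≤ G)
    {s : ℕ → ℝ} (hs0 : ∀ i, 0 ≤ s i)
    (hs : ∀ i, s i ≤ G * Real.exp (-(c * ((i : ℝ) + 1) ^ (1 / (d : ℝ))))) {n k : ℕ}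
    (hn : 0 < n) (hnk : n ≤ k) (h : t ^ k ≤ ∏ i ∈ Finset.range k, s i) :
    t ≤ G * Real.exp (-(d * c / (1 + d) * (n : ℝ) ^ (1 / (d : ℝ)))) := by
  set p : ℝ := 1 / (d : ℝ) with hp
  have hd' : (0 : ℝ) < d := by exact_mod_cast hd
  have hp0 : 0 ≤ p := by positivity
  have hk : 0 < k := hn.trans_le hnk
  have hk' : (0 : ℝ) < k := by exact_mod_cast hk
  have h1 : t ^ k ≤ (G * Real.exp (-(d * c / (1 + d) * (k : ℝ) ^ p))) ^ k := by
    refine h.trans ((Finset.prod_le_prod (fun i _ => hs0 i) fun i _ => hs i).trans ?_)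
    rw [Finset.prod_mul_distrib, Finset.prod_const, Finset.card_range, ← Real.exp_sum, mul_pow,
      ← Real.exp_nat_mul]
    refine mul_le_mul_of_nonneg_left (Real.exp_le_exp.2 ?_) (by positivity)
    have h2 := rpow_le_sum_rpow hp0 k
    rw [Real.rpow_add_one hk'.ne'] at h2
    rw [Finset.sum_neg_distrib, ← Finset.mul_sum]
    -- Since `p + 1 = (1+d)/d`, dividing `c` by it gives the rate `dc/(1+d)`.
    have h3 : (k : ℝ) * (-(d * c / (1 + d) * (k : ℝ) ^ p)) =
        -(c * ((k : ℝ) ^ p * k / (p + 1))) := by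
      rw [hp]; field_simp
    rw [h3, neg_le_neg_iff]
    refine mul_le_mul_of_nonneg_left ?_ hc
    rw [div_le_iff₀ (by linarith), mul_comm]
    linarith
  have h4 : t ≤ G * Real.exp (-(d * c / (1 + d) * (k : ℝ) ^ p)) := by
    by_contra hlt
    push Not at hlt
    exact absurd (pow_lt_pow_left₀ hlt (by positivity) hk.ne') (not_lt.2 h1)
  -- The bound decreases in `k`, so having `k` larger than `n` does no harm.
  refine h4.trans (mul_le_mul_of_nonneg_left (Real.exp_le_exp.2 (neg_le_neg ?_)) hG)
  refine mul_le_mul_of_nonneg_left ?_ (by positivity)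
  exact Real.rpow_le_rpow (by positivity) (by exact_mod_cast hnk) hp0

end Counting

/-! ### Smallness on a relatively covered domain. -/

section RelativeCovers

variable {d : ℕ} {Ω Ωt : Opens (CSpace d)} {N : ℕ}

theorem RelativeCover.efficiency_pos {Ω₁ Ω₂ : Set (CSpace d)} (R : RelativeCover Ω₁ Ω₂ N)
    (j : Fin N) : 0 < R.efficiency j := Real.log_pos (R.one_lt_γ j)

theorem subset_dilate {D : Set (CSpace d)} {ζ : CSpace d} (h : StrictlyCircled D ζ) {γ : ℝ}
    (hγ : 1 < γ) : D ⊆ dilate D ζ γ := by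
  intro z hz
  have hγ0 : (0 : ℝ) < γ := zero_lt_one.trans hγ
  refine ⟨ζ + ((γ⁻¹ : ℝ) : ℂ) • (z - ζ), h.smul_mem ?_ (by simpa using hz), ?_⟩
  · rw [Complex.norm_real, Real.norm_of_nonneg (by positivity)]
    exact inv_lt_one_of_one_lt₀ hγ
  · simp only [add_sub_cancel_left, smul_smul, ← Complex.ofReal_mul]
    rw [mul_inv_cancel₀ hγ0.ne']
    simp

/-- Functions on `Ω` vanishing to high order at the centres of a relative cover are small on the
smaller domain. -/
theorem RelativeCover.exists_functionals (hd : 0 < d)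
    (R : RelativeCover (Ω : Set (CSpace d)) Ωt N) {n : ℕ} (hn : 0 < n) :
    ∃ m < n, ∃ Λ : A2 Ω →ₗ[ℂ] (Fin m → ℂ), ∀ f, Λ f = 0 →
      eLpNorm f 2 ((V d).restrict Ωt) ≤ ENNReal.ofReal
        (N * Real.exp (-(((d : ℝ) - 1) / 2) * ⨅ j, R.efficiency j) *
          Real.exp (-(gaugeNorm d R.efficiency * (n : ℝ) ^ (1 / (d : ℝ))))) * ‖f‖ₑ := by
  classical
  set Γ := R.efficiency with hΓ
  set x := gaugeNorm d Γ * (n : ℝ) ^ (1 / (d : ℝ)) with hx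
  set y := ((d : ℝ) - 1) / 2 * ⨅ j, Γ j with hy
  have hd1 : (1 : ℝ) ≤ d := by exact_mod_cast hd
  have hN1 : (1 : ℝ) ≤ N := by exact_mod_cast R.size_pos
  obtain ⟨k, hksum, hk⟩ := exists_vanishing_orders R.size_pos R.efficiency_pos hd hn
  have hdil : ∀ j, dilate (R.D j) (R.centre j) (R.γ j) ⊆ Ω := fun j =>
    (Set.subset_iUnion (fun j => dilate (R.D j) (R.centre j) (R.γ j)) j).trans
      R.iUnion_dilate_subset
  have hΛ : ∀ j, ∃ Λ : A2 Ω →ₗ[ℂ] (Fin ((k j + d - 1).choose d) → ℂ), ∀ f, Λ f = 0 →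
      ENNReal.ofReal (R.γ j ^ (2 * (k j + d))) * ∫⁻ z in R.D j, ‖f z‖ₑ ^ 2 ∂(V d) ≤
        ‖f‖ₑ ^ 2 := by
    intro j
    rcases (R.D j).eq_empty_or_nonempty with hD | hD
    -- The centre of an empty `D j` may lie outside `Ω`, but its integral vanishes and zero
    -- functionals suffice.
    · exact ⟨0, fun f _ => by simp [hD]⟩
    · have hc : R.centre j ∈ Ω := hdil j
        (subset_dilate (R.strictlyCircled j) (R.one_lt_γ j) ((R.strictlyCircled j).centre_mem hD))
      obtain ⟨Λ, h⟩ := exists_vanishing_functionals hd hc (k j)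
      refine ⟨Λ, fun f hf => ?_⟩
      rw [A2.enorm_def, eLpNorm_two_sq]
      exact (R.strictlyCircled j).pow_mul_lintegral_le (R.isOpen j) (R.one_lt_γ j) (hdil j) f
        (h f hf)
  choose Λ hΛ using hΛ
  -- All conditions, at all centres, are collected into one map.
  let e := finSigmaFinEquiv (n := fun j => (k j + d - 1).choose d)
  refine ⟨_, hksum, LinearMap.pi fun i => (LinearMap.proj (e.symm i).2).comp (Λ (e.symm i).1),
    fun f hf => ?_⟩
  have hf' : ∀ j, Λ j f = 0 := fun j => funext fun i => by
    have h1 : Λ (e.symm (e ⟨j, i⟩)).1 f (e.symm (e ⟨j, i⟩)).2 = 0 := congrFun hf (e ⟨j, i⟩)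
    rw [Equiv.symm_apply_apply] at h1
    exact h1
  have hD : ∀ j, ∫⁻ z in R.D j, ‖f z‖ₑ ^ 2 ∂(V d) ≤
      ENNReal.ofReal (Real.exp (-(x + y)) ^ 2) * ‖f‖ₑ ^ 2 := by
    intro j
    have hγ0 : (0 : ℝ) < R.γ j := zero_lt_one.trans (R.one_lt_γ j)
    have h1 : R.γ j ^ (2 * (k j + d)) = Real.exp (Γ j * (k j + d)) ^ 2 := by
      rw [mul_comm 2, pow_mul]
      congr 1
      have h2 : R.γ j = Real.exp (Γ j) := (Real.exp_log hγ0).symm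
      conv_lhs => rw [h2, ← Real.exp_nat_mul]
      push_cast
      ring_nf
    have h3 : Real.exp (x + y) ^ 2 ≤ R.γ j ^ (2 * (k j + d)) := by
      rw [h1]
      refine pow_le_pow_left₀ (Real.exp_pos _).le (Real.exp_le_exp.2 (le_trans ?_ (hk j))) 2
      have h4 : ⨅ j, Γ j ≤ Γ j := ciInf_le (Set.finite_range Γ).bddBelow j
      have h5 := mul_le_mul_of_nonneg_left h4 (show 0 ≤ ((d : ℝ) - 1) / 2 by linarith)
      linarith
    calc ∫⁻ z in R.D j, ‖f z‖ₑ ^ 2 ∂(V d)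
        = ENNReal.ofReal (Real.exp (-(x + y)) ^ 2) * (ENNReal.ofReal (Real.exp (x + y) ^ 2) *
            ∫⁻ z in R.D j, ‖f z‖ₑ ^ 2 ∂(V d)) := by
          rw [← mul_assoc, ← ENNReal.ofReal_mul (by positivity), ← mul_pow, ← Real.exp_add]
          simp
      _ ≤ _ := by
          refine mul_le_mul_right (le_trans ?_ (hΛ j f (hf' j))) _
          exact mul_le_mul_left (ENNReal.ofReal_le_ofReal h3) _
  have htotal : eLpNorm f 2 ((V d).restrict Ωt) ^ 2 ≤
      (ENNReal.ofReal (N * Real.exp (-(x + y))) * ‖f‖ₑ) ^ 2 := by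
    rw [eLpNorm_two_sq]
    calc ∫⁻ z in Ωt, ‖f z‖ₑ ^ 2 ∂(V d)
        ≤ ∫⁻ z in ⋃ j, R.D j, ‖f z‖ₑ ^ 2 ∂(V d) := lintegral_mono_set R.subset_iUnion
      _ ≤ ∑' j, ∫⁻ z in R.D j, ‖f z‖ₑ ^ 2 ∂(V d) := lintegral_iUnion_le _ _
      _ = ∑ j, ∫⁻ z in R.D j, ‖f z‖ₑ ^ 2 ∂(V d) := tsum_fintype _
      _ ≤ ∑ _j : Fin N, ENNReal.ofReal (Real.exp (-(x + y)) ^ 2) * ‖f‖ₑ ^ 2 :=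
          Finset.sum_le_sum fun j _ => hD j
      _ = ENNReal.ofReal (N * Real.exp (-(x + y)) ^ 2) * ‖f‖ₑ ^ 2 := by
          rw [Finset.sum_const, Finset.card_univ, Fintype.card_fin, nsmul_eq_mul, ← mul_assoc,
            ENNReal.ofReal_mul (by positivity), ENNReal.ofReal_natCast]
      _ ≤ _ := by
          rw [mul_pow, ← ENNReal.ofReal_pow (by positivity)]
          refine mul_le_mul_left (ENNReal.ofReal_le_ofReal ?_) _
          rw [mul_pow]
          -- Summing the squares gives the factor `N`, which is bounded by `N ^ 2` to match the
          -- stated constant.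
          exact mul_le_mul_of_nonneg_right (by nlinarith) (by positivity)
  rw [ENNReal.pow_le_pow_left_iff two_ne_zero] at htotal
  have hexp : Real.exp (-(((d : ℝ) - 1) / 2) * ⨅ j, Γ j) * Real.exp (-x) =
      Real.exp (-(x + y)) := by
    rw [← Real.exp_add, hy]; ring_nf
  rwa [mul_assoc, hexp]

end RelativeCovers

/-! ### From kernel bounds to gauges and eigenvalue decay. -/

section ExponentialClass

variable {H : Type*} [NormedAddCommGroup H] [InnerProductSpace ℂ H]

theorem smallOnFiniteCodim_of_exp {A : H →L[ℂ] H} {C c α : ℝ} (hc : 0 < c) (hα : 0 < α)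
    (h : ∀ n : ℕ, KernelBound A n (C * Real.exp (-(c * ((n : ℝ) + 1) ^ α)))) :
    SmallOnFiniteCodim A := by
  intro ε hε
  have h1 : Tendsto (fun n : ℕ => C * Real.exp (-(c * ((n : ℝ) + 1) ^ α))) atTop (𝓝 (C * 0)) := by
    refine Tendsto.const_mul C (Real.tendsto_exp_neg_atTop_nhds_zero.comp ?_)
    exact Tendsto.const_mul_atTop hc ((tendsto_rpow_atTop hα).comp
      (tendsto_atTop_add_const_right _ 1 tendsto_natCast_atTop_atTop))
  rw [mul_zero] at h1
  obtain ⟨n, hn⟩ := (h1.eventually (gt_mem_nhds hε)).exists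
  exact ⟨n, (h n).mono le_rfl hn.le⟩

variable [CompleteSpace H]

theorem opGauge_le_of_kernelBound {A : H →L[ℂ] H} {C c α : ℝ} (hC : 0 ≤ C)
    (hA : SmallOnFiniteCodim A)
    (h : ∀ n : ℕ, KernelBound A n (C * Real.exp (-(c * ((n : ℝ) + 1) ^ α)))) :
    opGauge c α A ≤ ENNReal.ofReal C := by
  refine iSup_le fun n => ENNReal.ofReal_le_ofReal ?_
  have h1 := hA.singularValue_le (by positivity) (h n)
  rw [Complex.norm_real, Real.norm_of_nonneg (singularValue_nonneg A n)]
  calc _ ≤ C * Real.exp (-(c * ((n : ℝ) + 1) ^ α)) * Real.exp (c * ((n : ℝ) + 1) ^ α) :=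
        mul_le_mul_of_nonneg_right h1 (Real.exp_pos _).le
    _ = C := by rw [mul_assoc, ← Real.exp_add]; simp

theorem singularValue_le_opGauge {A : H →L[ℂ] H} {c α : ℝ} (h : opGauge c α A ≠ ∞) (n : ℕ) :
    singularValue A n ≤ (opGauge c α A).toReal * Real.exp (-(c * ((n : ℝ) + 1) ^ α)) := by
  have h1 : ENNReal.ofReal (‖(singularValue A n : ℂ)‖ * Real.exp (c * ((n : ℝ) + 1) ^ α)) ≤
      opGauge c α A :=
    le_iSup (fun n : ℕ => ENNReal.ofReal
      (‖(singularValue A n : ℂ)‖ * Real.exp (c * ((n : ℝ) + 1) ^ α))) n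
  rw [Complex.norm_real, Real.norm_of_nonneg (singularValue_nonneg A n),
    ENNReal.ofReal_le_iff_le_toReal h] at h1
  rw [Real.exp_neg, ← div_eq_mul_inv, le_div_iff₀ (Real.exp_pos _)]
  exact h1

/-- Eigenvalues of operators of exponential class. -/
theorem IsEigenvalueSequence.norm_le {d : ℕ} (hd : 0 < d) {A : H →L[ℂ] H} {c : ℝ} (hc : 0 ≤ c)
    (hA : SmallOnFiniteCodim A) (hG : opGauge c (1 / (d : ℝ)) A ≠ ∞) {lam : ℕ → ℂ}
    (hlam : IsEigenvalueSequence A lam) (n : ℕ) :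
    ‖lam n‖ ≤ (opGauge c (1 / (d : ℝ)) A).toReal *
      Real.exp (-(d * c / (1 + d) * ((n : ℝ) + 1) ^ (1 / (d : ℝ)))) := by
  by_cases h0 : lam n = 0
  · rw [h0, norm_zero]
    positivity
  obtain ⟨k, hk, hprod⟩ := hlam.exists_pow_le_prod hA h0
  have h1 := le_of_pow_le_prod hd hc ENNReal.toReal_nonneg (singularValue_nonneg A)
    (singularValue_le_opGauge hG) n.succ_pos hk hprod
  rwa [Nat.cast_succ] at h1

end ExponentialClass

/-! ### Assembly for transfer operators. -/

variable {d : ℕ} {Ω Ωt : Opens (CSpace d)} {I : Type*}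

theorem MapWeightSystem.enorm_comp_le (S : MapWeightSystem Ω I)
    (hS : CompactlyContained (⋃ i, S.φ i '' Ω) (Ωt : Set (CSpace d))) (hsub : Ωt ≤ Ω)
    {i : I} (hr : 0 < setDist (S.φ i '' Ω) (frontier (Ωt : Set (CSpace d)))) (f : A2 Ω)
    {z : CSpace d} (hz : z ∈ Ω) :
    ‖f (S.φ i z)‖ₑ ≤
      ENNReal.ofReal ((setDist (S.φ i '' Ω) (frontier (Ωt : Set (CSpace d))) ^ d)⁻¹) *
        eLpNorm f 2 ((V d).restrict Ωt) := by
  have hmem : S.φ i z ∈ S.φ i '' Ω := Set.mem_image_of_mem _ hz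
  exact A2.enorm_apply_le f hsub hr
    (ball_subset_of_le_setDist Ωt.isOpen hmem (hS.2 (S.image_subset i hmem)) le_rfl)

theorem MapWeightSystem.eLpNorm_tsum_mul_lt_top (S : MapWeightSystem Ω I) {a : I → ℝ≥0∞} {M : ℝ}
    (ha : ∀ i, a i ≤ ENNReal.ofReal M) :
    eLpNorm (fun z => ∑' i, ‖S.w i z‖ₑ * a i) 2 ((V d).restrict Ω) < ∞ := by
  have h1 : eLpNorm (fun z => ∑' i, ‖S.w i z‖ₑ * a i) 2 ((V d).restrict Ω) ≤
      eLpNorm (fun z => (∑' i, ‖S.w i z‖ₑ) * ENNReal.ofReal M) 2 ((V d).restrict Ω) := by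
    refine eLpNorm_mono_enorm fun z => ?_
    simp only [enorm_eq_self, ← ENNReal.tsum_mul_right]
    exact ENNReal.tsum_le_tsum fun i => mul_le_mul_right (ha i) _
  refine h1.trans_lt ?_
  rw [eLpNorm_two_mul_const _ ENNReal.ofReal_ne_top]
  exact ENNReal.mul_lt_top S.summable_weights ENNReal.ofReal_lt_top

/-- An operator which is controlled by restriction to a relatively covered set. -/
theorem RelativeCover.kernelBound {N : ℕ} (hd : 0 < d)
    (R : RelativeCover (Ω : Set (CSpace d)) Ωt N) {L : A2 Ω →L[ℂ] A2 Ω} {W : ℝ≥0∞} (hW : W ≠ ∞)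
    (hL : ∀ f, ‖L f‖ₑ ≤ W * eLpNorm f 2 ((V d).restrict Ωt)) (n : ℕ) :
    KernelBound L n
      (N * Real.exp (-(((d : ℝ) - 1) / 2) * ⨅ j, R.efficiency j) * W.toReal *
        Real.exp (-(gaugeNorm d R.efficiency * ((n : ℝ) + 1) ^ (1 / (d : ℝ))))) := by
  obtain ⟨m, hm, Λ, hΛ⟩ := R.exists_functionals hd n.succ_pos
  -- Fewer than `n + 1` conditions means codimension at most `n`: this matches singular values
  -- indexed from `0` with the exponent in `n + 1`.
  refine ⟨m, Nat.lt_succ_iff.1 hm, Λ, fun f hf => ?_⟩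
  have h1 := (hL f).trans (mul_le_mul_right (hΛ f hf) W)
  have h2 := ENNReal.toReal_mono (by finiteness) h1
  simp only [ENNReal.toReal_mul, toReal_enorm] at h2
  rw [ENNReal.toReal_ofReal (by positivity)] at h2
  refine h2.trans_eq ?_
  push_cast
  ring

theorem IsEigenvalueSequence.seqGauge_le {H : Type*} [NormedAddCommGroup H]
    [InnerProductSpace ℂ H] [CompleteSpace H] (hd : 0 < d) {A : H →L[ℂ] H} {c : ℝ} (hc : 0 ≤ c)
    (hA : SmallOnFiniteCodim A) (hG : opGauge c (1 / (d : ℝ)) A ≠ ∞) {lam : ℕ → ℂ}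
    (hlam : IsEigenvalueSequence A lam) :
    seqGauge (d * c / (1 + d)) (1 / (d : ℝ)) lam ≤ opGauge c (1 / (d : ℝ)) A := by
  refine iSup_le fun n => ?_
  rw [ENNReal.ofReal_le_iff_le_toReal hG, ← le_div_iff₀ (Real.exp_pos _), div_eq_mul_inv,
    ← Real.exp_neg]
  exact hlam.norm_le hd hc hA hG n

end Bergman

end

theorem theorem5p9 {d : ℕ} (hd : 0 < d) {I : Type*} [Countable I]
    (Ω Ωt : TopologicalSpace.Opens (Bergman.CSpace d))
    (hΩ : (Ω : Set (Bergman.CSpace d)).Nonempty) (hΩt : (Ωt : Set (Bergman.CSpace d)).Nonempty)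
    (S : Bergman.MapWeightSystem Ω I)
    (hS : Bergman.CompactlyContained (⋃ i, S.φ i '' Ω) (Ωt : Set (Bergman.CSpace d)))
    (hΩtΩ : Bergman.CompactlyContained (Ωt : Set (Bergman.CSpace d)) Ω)
    {N : ℕ} (R : Bergman.RelativeCover (Ω : Set (Bergman.CSpace d)) Ωt N) :
    ∃ L : Bergman.A2 Ω →L[ℂ] Bergman.A2 Ω,
      S.IsTransferOperator L ∧
      L ∈ Bergman.expClass (Bergman.gaugeNorm d R.efficiency) (1 / (d : ℝ)) ∧
      Bergman.opGauge (Bergman.gaugeNorm d R.efficiency) (1 / (d : ℝ)) L ≤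
        ENNReal.ofReal (N * Real.exp (-(((d : ℝ) - 1) / 2) * ⨅ n, R.efficiency n)) *
          MeasureTheory.eLpNorm
            (fun z => ∑' i, ‖S.w i z‖ₑ * ENNReal.ofReal
              ((Bergman.setDist (S.φ i '' Ω) (frontier (Ωt : Set (Bergman.CSpace d))) ^ d)⁻¹))
            2 ((Bergman.V d).restrict Ω) ∧
      (∃ lam : ℕ → ℂ, Bergman.IsEigenvalueSequence L lam) ∧
      ∀ lam : ℕ → ℂ, Bergman.IsEigenvalueSequence L lam →
        lam ∈ Bergman.seqClass
          (d * Bergman.gaugeNorm d R.efficiency / (1 + d)) (1 / (d : ℝ)) ∧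
        Bergman.seqGauge
            (d * Bergman.gaugeNorm d R.efficiency / (1 + d)) (1 / (d : ℝ)) lam ≤
          Bergman.opGauge (Bergman.gaugeNorm d R.efficiency) (1 / (d : ℝ)) L ∧
        ∀ n : ℕ, 1 ≤ n →
          ‖lam (n - 1)‖ ≤
            (Bergman.opGauge (Bergman.gaugeNorm d R.efficiency) (1 / (d : ℝ)) L).toReal *
              Real.exp (-(d * Bergman.gaugeNorm d R.efficiency / (1 + d)) *
                (n : ℝ) ^ (1 / (d : ℝ))) := by
  have : Nonempty (Fin d) := ⟨⟨0, hd⟩⟩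
  have : Nontrivial (Bergman.CSpace d) := inferInstance
  have hsub : (Ωt : Set (Bergman.CSpace d)) ⊆ Ω := subset_closure.trans hΩtΩ.2
  -- A positive lower bound on the `r_i`, uniform in `i`, makes the weighted majorant finite in
  -- `L²`, given that `∑ |w_i|` is.
  obtain ⟨δ, hδ, hdist⟩ := Bergman.exists_pos_le_setDist Ωt.isOpen hΩt hΩtΩ.1 hS
  have hr : ∀ i, δ ≤ Bergman.setDist (S.φ i '' Ω) (frontier (Ωt : Set (Bergman.CSpace d))) :=
    fun i => hdist _ (Set.subset_iUnion (fun i => S.φ i '' Ω) i) (hΩ.image _)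
  have hW : MeasureTheory.eLpNorm (fun z => ∑' i, ‖S.w i z‖ₑ * ENNReal.ofReal
      ((Bergman.setDist (S.φ i '' Ω) (frontier (Ωt : Set (Bergman.CSpace d))) ^ d)⁻¹)) 2
        ((Bergman.V d).restrict Ω) < ∞ :=
    S.eLpNorm_tsum_mul_lt_top (M := (δ ^ d)⁻¹) fun i => ENNReal.ofReal_le_ofReal
      (inv_anti₀ (pow_pos hδ d) (pow_le_pow_left₀ hδ.le (hr i) d))
  obtain ⟨L, hL, hLb⟩ := S.exists_isTransferOperator hsub _
    (fun f i z hz => S.enorm_comp_le hS hsub (hδ.trans_le (hr i)) f hz) hW.ne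
  have hc := Bergman.gaugeNorm_pos R.size_pos R.efficiency_pos d
  have hK := R.kernelBound hd hW.ne hLb
  have hsmall := Bergman.smallOnFiniteCodim_of_exp hc (by positivity) hK
  have hgauge := Bergman.opGauge_le_of_kernelBound (by positivity) hsmall hK
  rw [ENNReal.ofReal_mul (by positivity), ENNReal.ofReal_toReal hW.ne] at hgauge
  have hfin := hgauge.trans_lt (ENNReal.mul_lt_top ENNReal.ofReal_lt_top hW)
  refine ⟨L, hL, ⟨hsmall.isCompactOperator, hfin⟩, hgauge,
    hsmall.rieszOperator.exists_isEigenvalueSequence, fun lam hlam => ?_⟩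
  have hseq := hlam.seqGauge_le hd hc.le hsmall hfin.ne
  refine ⟨hseq.trans_lt hfin, hseq, fun n hn => ?_⟩
  have h := hlam.norm_le hd hc.le hsmall hfin.ne (n - 1)
  rwa [Nat.cast_sub hn, Nat.cast_one, sub_add_cancel, ← neg_mul] at h
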